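/- Let $Z$ be a complete separable metric space, let $X\subseteq Z$ be an analytic subset (with the induced metric), let $Y$ be a separable metric space and $(\Lambda,\mathcal P)$ a probability space. Let $\pi:\Lambda\times X\to Y$ be measurable (for the product of the $\sigma$-algebra of $\Lambda$ with the Borel $\sigma$-algebra of $X$, and the Borel $\sigma$-algebra of $Y$), and write $\pi_\lambda=\pi(\lambda,\cdot)$. Suppose that there are real numbers $\alpha,\kappa,C>0$ such that $$\mathcal P\big[\lambda\in\Lambda:\ d(\pi_\lambda(x_1),\pi_\lambda(x_2))\le\delta\, d(x_1,x_2)^\alpha\big]\le C\delta^\kappa$$ for all $\delta>0$ and all distinct $x_1,x_2\in X$. Let $\dim$ denote Hausdorff dimension. Then $$\dim\pi_\lambda(X)\ \ge\ \min\!\left(\kappa,\frac{\dim X}{\alpha}\right)\qquad\text{for }\mathcal P\text{-a.e. }\lambda\in\Lambda.$$ If moreover $\kappa=\dim Y$ and, in the case $\dim X<\alpha\kappa$, every map $\pi_\lambda$ is $\alpha$-Hölder (that is, there is a constant $K_\lambda$ with $d(\pi_\lambda(x_1),\pi_\lambda(x_2))\le K_\lambda\, d(x_1,x_2)^\alpha$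 for all $x_1,x_2\in X$), then $$\dim\pi_\lambda(X)=\min\!\left(\kappa,\frac{\dim X}{\alpha}\right)\qquad\text{for }\mathcal P\text{-a.e. }\lambda\in\Lambda.$$ -/

import Mathlib

open MeasureTheory Set
open scoped NNReal ENNReal

/-- The family of maps `π l : X → Y`, `l ∈ Λ`, is transversal with respect to `P`, with exponents
`α`, `κ` and constant `C`. The points are distinct: for `x₁ = x₂` the event on the left
is the whole parameter space, for every `δ`. -/
def IsTransversal {Λ X Y : Type*} [MeasurableSpace Λ] [MetricSpace X] [MetricSpace Y]
    (P : Measure Λ) (π : Λ → X → Y) (α κ C : ℝ≥0) : Prop :=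
  ∀ δ : ℝ, 0 < δ → ∀ x₁ x₂ : X, x₁ ≠ x₂ →
    P {l | dist (π l x₁) (π l x₂) ≤ δ * dist x₁ x₂ ^ (α : ℝ)} ≤ ENNReal.ofReal (C * δ ^ (κ : ℝ))

open Filter Topology Metric

/-! The lower bound is potential theoretic. Let `s < κ` and `α * s < dimH X`. A Frostman measure `μ`
on a compact `K ⊆ X` has finite `α * s`-energy. Transversality says that `d(π_λ x, π_λ y) / d(x,
y)^α` is at most `δ` with probability `O(δ^κ)`, so its moment of order `-s` is bounded uniformly in
`x ≠ y`. By Tonelli the mean `s`-energy of the image of `μ` is at most a constant times the `α *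
s`-energy of `μ`. Hence almost every image has finite `s`-energy, so dimension at least `s`;
rational `s` suffice. The upper bound is the Hölder estimate together with `dimH Y = κ`.

Most of the work is Frostman's lemma for analytic sets, `exists_frostman_measure`. The dyadic
`t`-content modulo sets of dimension at most `t` is positive when `t < dimH X`, and it passes to
arbitrary increasing unions (`dyadicContentMod_iUnion_le`): coverings converge along an ultrafilter,
and the pieces that have no limit are averaged away. Choquet's argument then gives a compact subset
of `X` all of whose neighbourhoods have content bounded below. Since fractional coverings can be
rounded to genuine ones (`dyadicContent_le_of_weights`), this compact set has no cheap fractional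
covering by balls, and Hahn-Banach with Riesz's theorem produces the measure
(`exists_measure_le_of_fractional_covers`). -/

/-- The Hausdorff content computed with dyadic scales: the infimum of `∑ k, N k * x ^ k` over all
coverings of `A` that use `N k` sets of diameter at most `2⁻¹ ^ k`. For `x = 2 ^ (-t)` this is a
`t`-dimensional content. -/
noncomputable def dyadicContent {Z : Type*} [PseudoEMetricSpace Z] (x : ℝ≥0∞) (A : Set Z) :
    ℝ≥0∞ :=
  ⨅ (N : ℕ → ℕ) (E : ℕ → ℕ → Set Z) (_ : ∀ k i, ediam (E k i) ≤ 2⁻¹ ^ k)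
    (_ : A ⊆ ⋃ k, ⋃ i < N k, E k i), ∑' k, (N k : ℝ≥0∞) * x ^ k

/-! ### Dyadic contents; rounding fractional coverings. -/

section Content

variable {Z : Type*}

theorem dyadicContent_le [PseudoEMetricSpace Z] {x : ℝ≥0∞} {A : Set Z} (N : ℕ → ℕ)
    (E : ℕ → ℕ → Set Z) (hE : ∀ k i, ediam (E k i) ≤ 2⁻¹ ^ k)
    (hA : A ⊆ ⋃ k, ⋃ i < N k, E k i) : dyadicContent x A ≤ ∑' k, (N k : ℝ≥0∞) * x ^ k :=
  iInf_le_of_le N (iInf_le_of_le E (iInf_le_of_le hE (iInf_le _ hA)))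

theorem exists_cover_of_dyadicContent_lt [PseudoEMetricSpace Z] {x a : ℝ≥0∞} {A : Set Z}
    (h : dyadicContent x A < a) : ∃ (N : ℕ → ℕ) (E : ℕ → ℕ → Set Z),
      (∀ k i, ediam (E k i) ≤ 2⁻¹ ^ k) ∧ A ⊆ ⋃ k, ⋃ i < N k, E k i ∧
        ∑' k, (N k : ℝ≥0∞) * x ^ k < a := by
  simp only [dyadicContent, iInf_lt_iff] at h
  obtain ⟨N, E, h1, h2, h3⟩ := h
  exact ⟨N, E, h1, h2, h3⟩

theorem dyadicContent_mono [PseudoEMetricSpace Z] {x : ℝ≥0∞} {A B : Set Z} (h : A ⊆ B) :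
    dyadicContent x A ≤ dyadicContent x B := by
  refine le_of_forall_gt fun a ha => ?_
  obtain ⟨N, E, h1, h2, h3⟩ := exists_cover_of_dyadicContent_lt ha
  exact (dyadicContent_le N E h1 (h.trans h2)).trans_lt h3

theorem ENNReal.rpow_neg_lt_one {t : ℝ} (ht : 0 < t) : (2 : ℝ≥0∞) ^ (-t) < 1 := by
  rw [ENNReal.rpow_neg, ENNReal.inv_lt_one]
  exact ENNReal.one_lt_rpow (by norm_num) ht

theorem ENNReal.two_rpow_ne_zero (t : ℝ) : (2 : ℝ≥0∞) ^ t ≠ 0 := by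
  simp [ENNReal.rpow_eq_zero_iff]

theorem ENNReal.two_rpow_ne_top (t : ℝ) : (2 : ℝ≥0∞) ^ t ≠ ⊤ := by
  simp [ENNReal.rpow_eq_top_iff]

theorem ENNReal.inv_two_pow_rpow (t : ℝ) (k : ℕ) :
    ((2 : ℝ≥0∞)⁻¹ ^ k) ^ t = ((2 : ℝ≥0∞) ^ (-t)) ^ k := by
  rw [← ENNReal.rpow_natCast, ← ENNReal.rpow_natCast, ← ENNReal.rpow_mul,
    ENNReal.inv_rpow, ← ENNReal.rpow_neg, ← ENNReal.rpow_mul]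
  congr 1
  ring

theorem dimH_le_of_dyadicContent_eq_zero [MetricSpace Z] {t : ℝ≥0} (ht : 0 < t)
    {A : Set Z} (h : dyadicContent ((2 : ℝ≥0∞) ^ (-(t : ℝ))) A = 0) : dimH A ≤ t := by
  borelize Z
  set x : ℝ≥0∞ := (2 : ℝ≥0∞) ^ (-(t : ℝ)) with hx
  have hx0 : x ≠ 0 := ENNReal.two_rpow_ne_zero _
  have hx1 : x < 1 := ENNReal.rpow_neg_lt_one (by exact_mod_cast ht)
  have hcov : ∀ m : ℕ, ∃ (N : ℕ → ℕ) (E : ℕ → ℕ → Set Z),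
      (∀ k i, ediam (E k i) ≤ 2⁻¹ ^ k) ∧ A ⊆ ⋃ k, ⋃ i < N k, E k i ∧
        ∑' k, (N k : ℝ≥0∞) * x ^ k < x ^ m := fun m =>
    exists_cover_of_dyadicContent_lt (by rw [h]; exact pos_iff_ne_zero.2 (pow_ne_zero _ hx0))
  choose N E hE hA hcost using hcov
  -- A single set at a scale `k < m` would already cost `x ^ k ≥ x ^ m`, so a cheap covering is
  -- automatically fine.
  have hscale : ∀ m k, 0 < N m k → m ≤ k := by
    intro m k hk
    by_contra! hlt
    have h1 : x ^ k ≤ ∑' k, (N m k : ℝ≥0∞) * x ^ k := by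
      refine le_trans ?_ (ENNReal.le_tsum k)
      exact le_mul_of_one_le_left zero_le (by exact_mod_cast hk)
    exact absurd (h1.trans_lt (hcost m)) (not_lt.2 (pow_le_pow_right_of_le_one' hx1.le hlt.le))
  have hlim : Tendsto (fun m : ℕ => x ^ m) atTop (𝓝 0) :=
    ENNReal.tendsto_pow_atTop_nhds_zero_of_lt_one hx1
  have hzero : μH[(t : ℝ)] A ≤ 0 := by
    refine (Measure.hausdorffMeasure_le_liminf_tsum (ι := fun m => Σ k, Fin (N m k)) (t : ℝ) A
      (fun m : ℕ => (2 : ℝ≥0∞)⁻¹ ^ m)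
      (ENNReal.tendsto_pow_atTop_nhds_zero_of_lt_one (by simp)) (fun m p => E m p.1 p.2)
      (Eventually.of_forall fun m p => ?_) (Eventually.of_forall fun m z hz => ?_)).trans ?_
    · refine (hE m p.1 p.2).trans (pow_le_pow_right_of_le_one' (by simp) (hscale m _ ?_))
      exact (Nat.zero_le _).trans_lt p.2.2
    · have := hA m hz
      simp only [mem_iUnion] at this ⊢
      obtain ⟨k, i, hi, hz⟩ := this
      exact ⟨⟨k, ⟨i, hi⟩⟩, hz⟩
    · rw [← hlim.liminf_eq]
      refine liminf_le_liminf (Eventually.of_forall fun m => ?_)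
      refine le_trans ?_ (hcost m).le
      rw [ENNReal.tsum_sigma']
      refine ENNReal.tsum_le_tsum fun k => ?_
      calc ∑' i : Fin (N m k), ediam (E m k i) ^ (t : ℝ) ≤ ∑' i : Fin (N m k), x ^ k := by
            refine ENNReal.tsum_le_tsum fun i => ?_
            rw [hx, ← ENNReal.inv_two_pow_rpow]
            exact ENNReal.rpow_le_rpow (hE m k i) (by positivity)
        _ = N m k * x ^ k := by simp
  refine dimH_le_of_hausdorffMeasure_ne_top ?_
  rw [nonpos_iff_eq_zero.1 hzero]
  exact ENNReal.zero_ne_top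

theorem Finset.exists_card_max {α : Type*} (p : Finset α → Prop) (h0 : p ∅) (b : ℕ)
    (hb : ∀ F, p F → F.card ≤ b) : ∃ F, p F ∧ ∀ G, p G → G.card ≤ F.card := by
  have hne : (Finset.card '' {F | p F}).Nonempty := ⟨0, ∅, h0, rfl⟩
  have hbd : BddAbove (Finset.card '' {F | p F}) := ⟨b, by rintro _ ⟨F, hF, rfl⟩; exact hb F hF⟩
  obtain ⟨F, hF, hFc⟩ := Nat.sSup_mem hne hbd
  exact ⟨F, hF, fun G hG => hFc ▸ le_csSup hbd ⟨G, hG, rfl⟩⟩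

/-- If sets of diameter at most `r` with total weight `W < ∞` cover every point of `S` with weight
at least `θ`, then `S` is covered by at most `W / θ` closed balls of radius `r`. -/
theorem exists_finset_cover_of_weights [PseudoEMetricSpace Z] {ι : Type*} {S : Set Z}
    (w : ι → ℝ≥0∞) (E : ι → Set Z) {r θ : ℝ≥0∞} (hE : ∀ i, w i ≠ 0 → ediam (E i) ≤ r)
    (hθ : θ ≠ 0) (hW : ∑' i, w i ≠ ⊤)
    (hS : ∀ z ∈ S, θ ≤ ∑' i, (E i).indicator (fun _ => w i) z) :
    ∃ F : Finset Z, (F.card : ℝ≥0∞) * θ ≤ ∑' i, w i ∧ S ⊆ ⋃ z ∈ F, closedEBall z r := by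
  classical
  -- Sets of diameter at most `r` contain at most one point of an `r`-separated `F ⊆ S`, which
  -- bounds `F.card`; an `F` of maximal cardinality is then an `r`-net of `S`.
  let p : Finset Z → Prop := fun F => ↑F ⊆ S ∧ ∀ y ∈ F, ∀ z ∈ F, y ≠ z → r < edist y z
  have hcard : ∀ F, p F → (F.card : ℝ≥0∞) * θ ≤ ∑' i, w i := by
    rintro F ⟨hFS, hF⟩
    calc (F.card : ℝ≥0∞) * θ = ∑ z ∈ F, θ := by simp
      _ ≤ ∑ z ∈ F, ∑' i, (E i).indicator (fun _ => w i) z :=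
        Finset.sum_le_sum fun z hz => hS z (hFS hz)
      _ = ∑' i, ∑ z ∈ F, (E i).indicator (fun _ => w i) z :=
        (Summable.tsum_finsetSum fun _ _ => ENNReal.summable).symm
      _ ≤ ∑' i, w i := by
        refine ENNReal.tsum_le_tsum fun i => ?_
        by_cases hw : w i = 0
        · simp [hw]
        by_cases hex : ∃ y ∈ F, y ∈ E i
        · obtain ⟨y, hyF, hyE⟩ := hex
          rw [Finset.sum_eq_single_of_mem y hyF]
          · simp [hyE]
          · intro z hz hzy
            refine indicator_of_notMem (fun hzE => ?_) _
            exact absurd (edist_le_of_ediam_le hzE hyE (hE i hw)) (not_le.2 (hF z hz y hyF hzy))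
        · push Not at hex
          rw [Finset.sum_eq_zero fun z hz => indicator_of_notMem (hex z hz) _]
          exact zero_le
  obtain ⟨b, hb⟩ := ENNReal.exists_nat_gt (ENNReal.div_ne_top hW hθ)
  obtain ⟨F, hF, hmax⟩ := Finset.exists_card_max p (by simp [p]) b (fun F hF => by
    have h1 : (F.card : ℝ≥0∞) ≤ (∑' i, w i) / θ :=
      (ENNReal.le_div_iff_mul_le (Or.inl hθ) (Or.inr hW)).2 (hcard F hF)
    exact_mod_cast (h1.trans_lt hb).le)
  refine ⟨F, hcard F hF, fun z hz => ?_⟩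
  by_contra hnot
  simp only [mem_iUnion, mem_closedEBall, exists_prop, not_exists, not_and, not_le] at hnot
  have hzF : z ∉ F := fun h => by simpa using hnot z h
  have := hmax (insert z F) ⟨?_, ?_⟩
  · rw [Finset.card_insert_of_notMem hzF] at this
    omega
  · simp only [Finset.coe_insert]
    exact insert_subset hz hF.1
  · intro a ha b hb hab
    rw [Finset.mem_insert] at ha hb
    rcases ha with rfl | ha <;> rcases hb with rfl | hb
    · exact absurd rfl hab
    · exact hnot b hb
    · rw [edist_comm]; exact hnot a ha
    · exact hF.2 a ha b hb hab

/-- A fractional covering of cost `M` with ratio `x` bounds the content with any smaller ratio. -/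
theorem dyadicContent_le_of_weights [PseudoEMetricSpace Z] {ι : Type*} {x y : ℝ≥0∞} (hy : y ≠ 0)
    (hyx : y < x) (hx : x ≠ ⊤) {S : Set Z} (w : ι → ℝ≥0∞) (κ : ι → ℕ) (E : ι → Set Z)
    (hE : ∀ i, w i ≠ 0 → ediam (E i) ≤ 2⁻¹ ^ (κ i + 1))
    (hS : ∀ z ∈ S, 1 ≤ ∑' i, (E i).indicator (fun _ => w i) z) :
    (1 - y / x) / 2 * dyadicContent y S ≤ ∑' i, w i * x ^ κ i := by
  classical
  have hx0 : x ≠ 0 := (pos_iff_ne_zero.2 hy).trans hyx |>.ne'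
  set q := y / x with hq
  have hq1 : q < 1 := by
    rw [hq, ENNReal.div_lt_iff (Or.inl hx0) (Or.inl hx), one_mul]; exact hyx
  have hq0 : q ≠ 0 := ENNReal.div_ne_zero.2 ⟨hy, hx⟩
  have hqx : q * x = y := ENNReal.div_mul_cancel hx0 hx
  -- The thresholds `θ₀ * q ^ k` sum to `1 / 2 < 1`, so every point of `S` meets the threshold at
  -- some scale `k`. The factor `q ^ k` is what turns the price `x ^ k` into `y ^ k`.
  set θ₀ := (1 - q) / 2 with hθ₀
  have h1q : 1 - q ≠ 0 := (tsub_pos_of_lt hq1).ne'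
  have h1q' : 1 - q ≠ ⊤ := ENNReal.sub_ne_top ENNReal.one_ne_top
  have hθ0 : θ₀ ≠ 0 := ENNReal.div_ne_zero.2 ⟨h1q, by simp⟩
  by_cases hM : ∑' i, w i * x ^ κ i = ⊤
  · rw [hM]; exact le_top
  let v : ℕ → ι → ℝ≥0∞ := fun k i => if κ i = k then w i else 0
  have hcost : ∑' k, (∑' i, v k i) * x ^ k = ∑' i, w i * x ^ κ i := by
    simp_rw [← ENNReal.tsum_mul_right]
    rw [ENNReal.tsum_comm]
    refine tsum_congr fun i => ?_
    rw [tsum_eq_single (κ i)]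
    · simp [v]
    · intro k hk
      simp [v, hk.symm]
  have hv : ∀ k, ∑' i, v k i ≠ ⊤ := by
    intro k hk
    refine hM (top_le_iff.1 ?_)
    rw [← hcost]
    refine le_trans ?_ (ENNReal.le_tsum k)
    rw [hk, ENNReal.top_mul (pow_ne_zero _ hx0)]
  have key : ∀ k, ∃ F : Finset Z, (F.card : ℝ≥0∞) * (θ₀ * q ^ k) ≤ ∑' i, v k i ∧
      {z ∈ S | θ₀ * q ^ k ≤ ∑' i, (E i).indicator (fun _ => v k i) z} ⊆
        ⋃ z ∈ F, closedEBall z (2⁻¹ ^ (k + 1)) := by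
    intro k
    refine exists_finset_cover_of_weights (v k) E ?_ (mul_ne_zero hθ0 (pow_ne_zero _ hq0)) (hv k)
      fun z hz => hz.2
    intro i hi
    by_cases hik : κ i = k
    · rw [← hik]
      refine hE i fun h0 => hi ?_
      simp [v, h0]
    · simp [v, hik] at hi
  choose F hFcard hFcov using key
  let e : ∀ k, Fin (F k).card ≃ F k := fun k => (F k).equivFin.symm
  have hle : dyadicContent y S ≤ ∑' k, ((F k).card : ℝ≥0∞) * y ^ k := by
    -- Passing from sets to balls doubles the diameter; the spare factor in `2⁻¹ ^ (κ i + 1)`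
    -- absorbs this.
    refine dyadicContent_le _ (fun k i => if h : i < (F k).card then
      closedEBall (e k ⟨i, h⟩ : Z) (2⁻¹ ^ (k + 1)) else ∅) (fun k i => ?_) ?_
    · split_ifs with h
      · refine ediam_closedEBall_le.trans ?_
        rw [pow_succ', ← mul_assoc, ENNReal.mul_inv_cancel (by simp) (by simp), one_mul]
      · simp
    · intro z hz
      have : ∃ k, θ₀ * q ^ k ≤ ∑' i, (E i).indicator (fun _ => v k i) z := by
        by_contra! hcon
        have h1 := hS z hz
        have h2 : ∑' i, (E i).indicator (fun _ => w i) z =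
            ∑' k, ∑' i, (E i).indicator (fun _ => v k i) z := by
          rw [ENNReal.tsum_comm]
          refine tsum_congr fun i => ?_
          rw [tsum_eq_single (κ i)]
          · simp [v]
          · intro k hk
            simp [v, hk.symm]
        rw [h2] at h1
        have h3 : ∑' k, ∑' i, (E i).indicator (fun _ => v k i) z ≤ 2⁻¹ := by
          refine (ENNReal.tsum_le_tsum fun k => (hcon k).le).trans ?_
          rw [ENNReal.tsum_mul_left, ENNReal.tsum_geometric, hθ₀, ENNReal.div_eq_inv_mul,
            mul_assoc, ENNReal.mul_inv_cancel h1q h1q', mul_one]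
        exact absurd (h1.trans h3) (by simp)
      obtain ⟨k, hk⟩ := this
      have := hFcov k ⟨hz, hk⟩
      simp only [mem_iUnion] at this ⊢
      obtain ⟨c, hc, hzc⟩ := this
      refine ⟨k, ((e k).symm ⟨c, hc⟩ : ℕ), ((e k).symm ⟨c, hc⟩).2, ?_⟩
      rw [dif_pos ((e k).symm ⟨c, hc⟩).2]
      simpa using hzc
  calc θ₀ * dyadicContent y S ≤ θ₀ * ∑' k, ((F k).card : ℝ≥0∞) * y ^ k := by gcongr
    _ = ∑' k, ((F k).card : ℝ≥0∞) * (θ₀ * q ^ k) * x ^ k := by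
      rw [← ENNReal.tsum_mul_left]
      refine tsum_congr fun k => ?_
      rw [← hqx, mul_pow]; ring
    _ ≤ ∑' k, (∑' i, v k i) * x ^ k := ENNReal.tsum_le_tsum fun k => by gcongr; exact hFcard k
    _ = _ := hcost

end Content

/-! ### Averaging coverings whose coarse pieces wander off. -/

section Increasing

variable {Z : Type*}

theorem dyadicContent_union_le [PseudoEMetricSpace Z] (x : ℝ≥0∞) (A B : Set Z) :
    dyadicContent x (A ∪ B) ≤ dyadicContent x A + dyadicContent x B := by
  refine ENNReal.le_of_forall_pos_le_add fun ε hε hfin => ?_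
  have hε2 : (ε / 2 : ℝ≥0∞) ≠ 0 := by simpa using hε.ne'
  have hA := ENNReal.lt_add_right ((le_self_add).trans_lt hfin).ne hε2
  have hB := ENNReal.lt_add_right ((le_add_self).trans_lt hfin).ne hε2
  obtain ⟨N, E, h1, h2, h3⟩ := exists_cover_of_dyadicContent_lt hA
  obtain ⟨N', E', h1', h2', h3'⟩ := exists_cover_of_dyadicContent_lt hB
  refine (dyadicContent_le (fun k => N k + N' k)
    (fun k i => if i < N k then E k i else E' k (i - N k)) (fun k i => ?_) ?_).trans ?_
  · split_ifs
    exacts [h1 k i, h1' k _]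
  · rintro z (hz | hz)
    · have := h2 hz
      simp only [mem_iUnion, exists_prop] at this ⊢
      obtain ⟨k, i, hi, hz⟩ := this
      exact ⟨k, i, by omega, by rwa [if_pos hi]⟩
    · have := h2' hz
      simp only [mem_iUnion, exists_prop] at this ⊢
      obtain ⟨k, i, hi, hz⟩ := this
      exact ⟨k, N k + i, by omega, by rw [if_neg (by omega)]; simpa using hz⟩
  · calc ∑' k, ((N k + N' k : ℕ) : ℝ≥0∞) * x ^ k
        = ∑' k, (N k : ℝ≥0∞) * x ^ k + ∑' k, (N' k : ℝ≥0∞) * x ^ k := by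
          rw [← ENNReal.tsum_add]
          refine tsum_congr fun k => ?_
          push_cast; ring
      _ ≤ (dyadicContent x A + ε / 2) + (dyadicContent x B + ε / 2) := add_le_add h3.le h3'.le
      _ = dyadicContent x A + dyadicContent x B + ε := by
          rw [add_add_add_comm, ENNReal.add_halves]

/-- Along a nonprincipal ultrafilter one can choose arbitrarily many members of a sequence of
indexed families such that all wandering indices of a given finite set give disjoint sets. -/
theorem exists_finset_pairwise_disjoint {ι : Type*} (E : ℕ → ι → Set Z) (J : Finset ι)
    (hJ : ∀ j ∈ J, ∀ m, ∀ᶠ n in (hyperfilter ℕ : Filter ℕ), Disjoint (E m j) (E n j))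
    {G : Set ℕ} (hG : G ∈ (hyperfilter ℕ : Filter ℕ)) (M : ℕ) :
    ∃ F : Finset ℕ, F.card = M ∧ ↑F ⊆ G ∧
      ∀ m ∈ F, ∀ n ∈ F, m ≠ n → ∀ j ∈ J, Disjoint (E m j) (E n j) := by
  classical
  induction M with
  | zero => exact ⟨∅, by simp⟩
  | succ M ih =>
    obtain ⟨F, hc, hFG, hF⟩ := ih
    have h1 : ∀ᶠ n in (hyperfilter ℕ : Filter ℕ), ∀ m ∈ F, ∀ j ∈ J, Disjoint (E m j) (E n j) := by
      rw [Filter.eventually_all_finset]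
      intro m _
      rw [Filter.eventually_all_finset]
      exact fun j hj => hJ j hj m
    have h2 : ∀ᶠ n in (hyperfilter ℕ : Filter ℕ), n ∉ F :=
      hyperfilter_le_cofinite F.finite_toSet.compl_mem_cofinite
    obtain ⟨n, hn1, hn2, hnG⟩ := (h1.and (h2.and hG)).exists
    refine ⟨insert n F, by rw [Finset.card_insert_of_notMem hn2, hc], ?_, ?_⟩
    · rw [Finset.coe_insert]
      exact insert_subset hnG hFG
    · intro a ha b hb hab j hj
      rw [Finset.mem_insert] at ha hb
      rcases ha with rfl | ha <;> rcases hb with rfl | hb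
      · exact absurd rfl hab
      · exact (hn1 b hb j hj).symm
      · exact hn1 a ha j hj
      · exact hF a ha b hb hab j hj

/-- If the parts of the coverings at scales below `K` wander off, then averaging many of them gives
a fractional covering that uses scales at least `K` only. -/
theorem dyadicContent_le_of_wandering [PseudoEMetricSpace Z] {S : Set Z} {x x' y b : ℝ≥0∞}
    (hy : y ≠ 0) (hyx : y < x') (hxx : x' < x) (hx : x ≠ ⊤)
    (N : ℕ → ℕ → ℕ) (E : ℕ → ℕ → ℕ → Set Z) (hE : ∀ n k i, ediam (E n k i) ≤ 2⁻¹ ^ k)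
    (hcost : ∀ n, ∑' k, (N n k : ℝ≥0∞) * x ^ k ≤ b) (Nl : ℕ → ℕ) (K : ℕ) (hK : 1 ≤ K)
    (hS : ∀ᶠ n in (hyperfilter ℕ : Filter ℕ), ∀ z ∈ S, ∃ k i, i < N n k ∧ z ∈ E n k i ∧
      (k < K → i < Nl k ∧ ∀ m, ∀ᶠ l in (hyperfilter ℕ : Filter ℕ),
        Disjoint (E m k i) (E l k i))) :
    (1 - y / x') / 2 * dyadicContent y S ≤ 2 * b * x'⁻¹ * (x' / x) ^ K := by
  classical
  have hx'0 : x' ≠ 0 := (pos_iff_ne_zero.2 hy).trans hyx |>.ne'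
  have hx'top : x' ≠ ⊤ := (hxx.trans_le le_top).ne
  have hx0 : x ≠ 0 := (pos_iff_ne_zero.2 hx'0).trans hxx |>.ne'
  set q := x' / x with hq
  have hqx : q * x = x' := ENNReal.div_mul_cancel hx0 hx
  have hq1 : q ≤ 1 := ENNReal.div_le_of_le_mul (by simpa using hxx.le)
  -- `J` holds the finitely many wandering indices below scale `K`. Among `2 * J.card + 1` coverings
  -- with disjoint pieces at every index of `J`, a point lies in coarse pieces of at most `J.card`,
  -- hence in fine pieces of at least `J.card + 1`. This dictates the weight `c⁻¹`, and the total
  -- cost is at most twice that of one covering.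
  let J : Finset (Σ _ : ℕ, ℕ) := ((Finset.range K).sigma fun k => Finset.range (Nl k)).filter
    fun p => ∀ m, ∀ᶠ l in (hyperfilter ℕ : Filter ℕ), Disjoint (E m p.1 p.2) (E l p.1 p.2)
  obtain ⟨F, hFc, hFG, hF⟩ := exists_finset_pairwise_disjoint (fun n p => E n p.1 p.2) J
    (fun j hj => (Finset.mem_filter.1 hj).2) hS (2 * J.card + 1)
  set c : ℝ≥0∞ := ((J.card + 1 : ℕ) : ℝ≥0∞) with hc
  have hc0 : c ≠ 0 := by simp [hc]
  have hctop : c ≠ ⊤ := ENNReal.natCast_ne_top _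
  let w : ℕ × ℕ × ℕ → ℝ≥0∞ := fun p => if p.1 ∈ F ∧ K ≤ p.2.1 ∧ p.2.2 < N p.1 p.2.1 then c⁻¹ else 0
  -- The scale is `k - 1` because rounding requires diameters `2⁻¹ ^ (κ + 1)`; the subtraction is
  -- exact since `1 ≤ K ≤ k`.
  refine (dyadicContent_le_of_weights hy hyx hx'top w (fun p => p.2.1 - 1)
    (fun p => E p.1 p.2.1 p.2.2) (fun p hp => ?_) (fun z hz => ?_)).trans ?_
  · have hp' : p.1 ∈ F ∧ K ≤ p.2.1 ∧ p.2.2 < N p.1 p.2.1 := by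
      by_contra hcon
      exact hp (if_neg hcon)
    rw [Nat.sub_add_cancel (hK.trans hp'.2.1)]
    exact hE _ _ _
  · have hex : ∀ n ∈ F, ∃ k i, i < N n k ∧ z ∈ E n k i ∧
      (k < K → i < Nl k ∧ ∀ m, ∀ᶠ l in (hyperfilter ℕ : Filter ℕ),
        Disjoint (E m k i) (E l k i)) := fun n hn => hFG hn z hz
    choose! k i hi hzE hki using hex
    have hbad : (F.filter fun n => k n < K).card ≤ J.card := by
      -- Injective: two coverings sharing an index of `J` would have disjoint pieces there, yet both
      -- pieces contain `z`.
      refine Finset.card_le_card_of_injOn (fun n => (⟨k n, i n⟩ : Σ _ : ℕ, ℕ)) ?_ ?_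
      · intro n hn
        obtain ⟨hnF, hnK⟩ := Finset.mem_filter.1 hn
        have := hki n hnF hnK
        simp only [J, Finset.coe_filter, mem_ofPred_eq, Finset.mem_sigma, Finset.mem_range]
        exact ⟨⟨hnK, this.1⟩, this.2⟩
      · intro n hn m hm hnm
        obtain ⟨hnF, hnK⟩ := Finset.mem_filter.1 hn
        obtain ⟨hmF, hmK⟩ := Finset.mem_filter.1 hm
        by_contra hne
        have h2 := hki n hnF hnK
        have hJ : (⟨k n, i n⟩ : Σ _ : ℕ, ℕ) ∈ J := by
          simp only [J, Finset.mem_filter, Finset.mem_sigma, Finset.mem_range]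
          exact ⟨⟨hnK, h2.1⟩, h2.2⟩
        have h1 := hF n hnF m hmF hne _ hJ
        simp only [Sigma.mk.injEq, heq_eq_eq] at hnm
        refine Set.disjoint_left.1 h1 (hzE n hnF) ?_
        rw [hnm.1, hnm.2]
        exact hzE m hmF
    have hgood : J.card + 1 ≤ (F.filter fun n => ¬ k n < K).card := by
      have := Finset.card_filter_add_card_filter_not (s := F) (fun n => k n < K)
      omega
    calc (1 : ℝ≥0∞) = c * c⁻¹ := (ENNReal.mul_inv_cancel hc0 hctop).symm
      _ ≤ ((F.filter fun n => ¬ k n < K).card : ℝ≥0∞) * c⁻¹ := by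
        gcongr
        rw [hc]
        exact_mod_cast hgood
      _ = ∑ n ∈ F.filter (fun n => ¬ k n < K), c⁻¹ := by simp
      _ ≤ ∑ n ∈ F.filter (fun n => ¬ k n < K),
          (E n (k n) (i n)).indicator (fun _ => w (n, k n, i n)) z := by
        refine Finset.sum_le_sum fun n hn => ?_
        obtain ⟨hnF, hnK⟩ := Finset.mem_filter.1 hn
        rw [indicator_of_mem (hzE n hnF)]
        simp only [w]
        rw [if_pos ⟨hnF, not_lt.1 hnK, hi n hnF⟩]
      _ = ∑ p ∈ (F.filter (fun n => ¬ k n < K)).image fun n => (n, k n, i n),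
          (E p.1 p.2.1 p.2.2).indicator (fun _ => w p) z := by
        rw [Finset.sum_image]
        intro a _ b _ hab
        exact (Prod.mk.inj hab).1
      _ ≤ _ := ENNReal.sum_le_tsum _
  · rw [ENNReal.tsum_prod']
    have hterm : ∀ n ∈ F, ∑' p : ℕ × ℕ, w (n, p) * x' ^ (p.1 - 1) ≤ c⁻¹ * (x'⁻¹ * q ^ K * b) := by
      intro n hn
      rw [ENNReal.tsum_prod']
      calc ∑' k, ∑' i, w (n, k, i) * x' ^ (k - 1)
          ≤ ∑' k, (c⁻¹ * (x'⁻¹ * q ^ K)) * (N n k * x ^ k) := by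
            refine ENNReal.tsum_le_tsum fun k => ?_
            by_cases hk : K ≤ k
            · have hpow : x' ^ (k - 1) ≤ x'⁻¹ * q ^ K * x ^ k := by
                calc x' ^ (k - 1) = x'⁻¹ * (x' * x' ^ (k - 1)) := by
                      rw [← mul_assoc, ENNReal.inv_mul_cancel hx'0 hx'top, one_mul]
                  _ = x'⁻¹ * (q ^ k * x ^ k) := by
                      rw [← pow_succ', Nat.sub_add_cancel (hK.trans hk), ← mul_pow, hqx]
                  _ ≤ x'⁻¹ * (q ^ K * x ^ k) := by
                      gcongr x'⁻¹ * (?_ * x ^ k)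
                      exact pow_le_pow_right_of_le_one' hq1 hk
                  _ = _ := by ring
              calc ∑' i, w (n, k, i) * x' ^ (k - 1)
                  = ∑ i ∈ Finset.range (N n k), c⁻¹ * x' ^ (k - 1) := by
                    rw [tsum_eq_sum (s := Finset.range (N n k))]
                    · refine Finset.sum_congr rfl fun i hi => ?_
                      simp only [w]
                      rw [if_pos ⟨hn, hk, Finset.mem_range.1 hi⟩]
                    · intro i hi
                      simp only [w]
                      rw [if_neg (fun h => hi (Finset.mem_range.2 h.2.2)), zero_mul]
                _ = N n k * (c⁻¹ * x' ^ (k - 1)) := by simp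
                _ ≤ N n k * (c⁻¹ * (x'⁻¹ * q ^ K * x ^ k)) := by gcongr
                _ = _ := by ring
            · have : ∀ i, w (n, k, i) * x' ^ (k - 1) = 0 := fun i => by
                simp only [w]
                rw [if_neg (fun h => hk h.2.1), zero_mul]
              simp [this]
        _ = c⁻¹ * (x'⁻¹ * q ^ K) * ∑' k, (N n k : ℝ≥0∞) * x ^ k := ENNReal.tsum_mul_left
        _ ≤ c⁻¹ * (x'⁻¹ * q ^ K) * b := by gcongr; exact hcost n
        _ = _ := by ring
    rw [tsum_eq_sum (s := F)]
    · refine (Finset.sum_le_sum hterm).trans ?_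
      rw [Finset.sum_const, hFc, nsmul_eq_mul]
      calc ((2 * J.card + 1 : ℕ) : ℝ≥0∞) * (c⁻¹ * (x'⁻¹ * q ^ K * b))
          ≤ (2 * c) * (c⁻¹ * (x'⁻¹ * q ^ K * b)) := by
            gcongr
            rw [hc]
            exact_mod_cast (by omega : 2 * J.card + 1 ≤ 2 * (J.card + 1))
        _ = 2 * (c * c⁻¹) * (x'⁻¹ * q ^ K * b) := by ring
        _ = 2 * b * x'⁻¹ * q ^ K := by
            rw [ENNReal.mul_inv_cancel hc0 hctop]; ring
    · intro n hn
      have : ∀ p, w (n, p) * x' ^ (p.1 - 1) = 0 := fun p => by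
        simp only [w]
        rw [if_neg (fun h => hn h.1), zero_mul]
      simp [this]

end Increasing

/-! ### Limits of coverings along an ultrafilter, and contents of increasing unions. -/

section Increasing

variable {Z : Type*}

/-- A sequence of sets of diameter at most `r` either stays, along the ultrafilter, in one set of
diameter at most `4 * r`, or it wanders off. -/
theorem exists_superset_or_wandering [PseudoEMetricSpace Z] (E : ℕ → Set Z) {r : ℝ≥0∞}
    (hE : ∀ n, ediam (E n) ≤ r) :
    (∃ D : Set Z, ediam D ≤ 4 * r ∧ ∀ᶠ n in (hyperfilter ℕ : Filter ℕ), E n ⊆ D) ∨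
      ∀ m, ∀ᶠ n in (hyperfilter ℕ : Filter ℕ), Disjoint (E m) (E n) := by
  refine or_iff_not_imp_right.2 fun h => ?_
  push Not at h
  obtain ⟨m, hm⟩ := h
  -- Sets that meet `E m` lie in its `r`-neighbourhood, of diameter at most `3 * r`. The bound is
  -- relaxed to `4 * r`, a shift by exactly two dyadic scales.
  refine ⟨{z | ∃ y ∈ E m, edist z y ≤ r}, ediam_le ?_, ?_⟩
  · rintro z ⟨y, hy, hzy⟩ z' ⟨y', hy', hzy'⟩
    calc edist z z' ≤ edist z y + edist y y' + edist y' z' := edist_triangle4 _ _ _ _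
      _ ≤ r + r + r := by
        gcongr
        · exact edist_le_of_ediam_le hy hy' (hE m)
        · rwa [edist_comm]
      _ = 3 * r := by ring
      _ ≤ 4 * r := by gcongr; norm_num
  · filter_upwards [hm] with n hn z hz
    obtain ⟨y, hym, hyn⟩ := Set.not_disjoint_iff.1 hn
    exact ⟨y, hym, edist_le_of_ediam_le hz hyn (hE n)⟩

/-- The Kuratowski limit of a sequence of sets along the ultrafilter. -/
def ultraLimit [TopologicalSpace Z] (E : ℕ → Set Z) : Set Z :=
  {z | ∀ V ∈ 𝓝 z, ∀ᶠ n in (hyperfilter ℕ : Filter ℕ), (V ∩ E n).Nonempty}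

theorem ediam_ultraLimit_le [PseudoEMetricSpace Z] (E : ℕ → Set Z) {r : ℝ≥0∞}
    (hE : ∀ n, ediam (E n) ≤ r) : ediam (ultraLimit E) ≤ r := by
  refine ediam_le fun z hz y hy => ?_
  refine ENNReal.le_of_forall_pos_le_add fun ε hε _ => ?_
  have hε2 : (0 : ℝ≥0∞) < ε / 2 := by simpa using hε.ne'
  obtain ⟨n, ⟨z', hz', hz'E⟩, y', hy', hy'E⟩ :=
    ((hz _ (eball_mem_nhds z hε2)).and (hy _ (eball_mem_nhds y hε2))).exists
  calc edist z y ≤ edist z z' + edist z' y' + edist y' y := edist_triangle4 _ _ _ _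
    _ ≤ ε / 2 + r + ε / 2 := by
      gcongr
      · rw [edist_comm]; exact (mem_eball.1 hz').le
      · exact edist_le_of_ediam_le hz'E hy'E (hE n)
      · exact (mem_eball.1 hy').le
    _ = r + (ε / 2 + ε / 2) := by ring
    _ = r + ε := by rw [ENNReal.add_halves]

theorem exists_nhds_disjoint_of_notMem_ultraLimit [TopologicalSpace Z] {E : ℕ → Set Z} {z : Z}
    (h : z ∉ ultraLimit E) :
    ∃ V ∈ 𝓝 z, ∀ᶠ n in (hyperfilter ℕ : Filter ℕ), Disjoint V (E n) := by
  simp only [ultraLimit, mem_ofPred_eq, not_forall] at h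
  obtain ⟨V, hV, h⟩ := h
  refine ⟨V, hV, ?_⟩
  rw [Filter.not_eventually, Ultrafilter.frequently_iff_eventually] at h
  filter_upwards [h] with n hn
  rwa [Set.disjoint_iff_inter_eq_empty, ← Set.not_nonempty_iff_eq_empty]

theorem exists_ultrafilter_limit_of_bounded (N : ℕ → ℕ) (M : ℕ) (h : ∀ n, N n ≤ M) :
    ∃ c, ∀ᶠ n in (hyperfilter ℕ : Filter ℕ), N n = c := by
  have : ∀ᶠ n in (hyperfilter ℕ : Filter ℕ), ∃ c ∈ Set.Iic M, N n = c :=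
    Eventually.of_forall fun n => ⟨N n, h n, rfl⟩
  obtain ⟨c, _, hc⟩ := (Ultrafilter.eventually_exists_mem_iff (Set.finite_Iic M)).1 this
  exact ⟨c, hc⟩

theorem ENNReal.tsum_eq_tsum_add_of_eq_zero {f : ℕ → ℝ≥0∞} (k : ℕ) (hf : ∀ i < k, f i = 0) :
    ∑' i, f i = ∑' i, f (i + k) := by
  have hs : Summable fun i => f (i + k) := ENNReal.summable
  have h := hs.sum_add_tsum_nat_add'
  rw [← h, Finset.sum_eq_zero fun i hi => hf i (Finset.mem_range.1 hi), zero_add]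

/-- If the sets of an increasing sequence have `t`-dimensional content less than `b`, then so does
their union, up to a set of dimension at most `t` and up to `ε`. -/
theorem exists_dyadicContent_le_dimH_diff_le [MetricSpace Z] [SecondCountableTopology Z] {t : ℝ≥0}
    (ht : 0 < t) (A : ℕ → Set Z) (hA : Monotone A) {b ε : ℝ≥0∞} (hb : b ≠ ⊤) (hε : ε ≠ 0)
    (hAb : ∀ n, dyadicContent ((2 : ℝ≥0∞) ^ (-(t : ℝ))) (A n) < b) :
    ∃ B : Set Z, dyadicContent ((2 : ℝ≥0∞) ^ (-(t : ℝ))) B ≤ b + ε ∧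
      dimH ((⋃ n, A n) \ B) ≤ t := by
  classical
  set x : ℝ≥0∞ := (2 : ℝ≥0∞) ^ (-(t : ℝ)) with hx
  have hx0 : x ≠ 0 := ENNReal.two_rpow_ne_zero _
  have hxtop : x ≠ ⊤ := ENNReal.two_rpow_ne_top _
  choose N E hE hcov hcost using fun n => exists_cover_of_dyadicContent_lt (hAb n)
  -- The cost bound gives `N n k ≤ b / x ^ k`, so each count is constant along the ultrafilter.
  have hNl : ∀ k, ∃ c, ∀ᶠ n in (hyperfilter ℕ : Filter ℕ), N n k = c := by
    intro k
    obtain ⟨M, hM⟩ := ENNReal.exists_nat_gt (ENNReal.div_ne_top hb (pow_ne_zero k hx0))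
    refine exists_ultrafilter_limit_of_bounded (fun n => N n k) M fun n => ?_
    have h1 : (N n k : ℝ≥0∞) ≤ b / x ^ k := by
      rw [ENNReal.le_div_iff_mul_le (Or.inl (pow_ne_zero k hx0)) (Or.inr hb)]
      exact (ENNReal.le_tsum k).trans (hcost n).le
    exact_mod_cast (h1.trans_lt hM).le
  choose Nl hNl using hNl
  have hNlK : ∀ K, ∀ᶠ n in (hyperfilter ℕ : Filter ℕ), ∀ k < K, N n k = Nl k := by
    intro K
    have := (Filter.eventually_all_finset (l := (hyperfilter ℕ : Filter ℕ)) (Finset.range K)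
      (p := fun k n => N n k = Nl k)).2 fun k _ => hNl k
    filter_upwards [this] with n hn k hk using hn k (Finset.mem_range.2 hk)
  have hsum : ∑' k, (Nl k : ℝ≥0∞) * x ^ k ≤ b := by
    refine ENNReal.tsum_le_of_sum_range_le fun K => ?_
    obtain ⟨n, hn⟩ := (hNlK K).exists
    calc ∑ k ∈ Finset.range K, (Nl k : ℝ≥0∞) * x ^ k
        = ∑ k ∈ Finset.range K, (N n k : ℝ≥0∞) * x ^ k :=
          Finset.sum_congr rfl fun k hk => by rw [hn k (Finset.mem_range.1 hk)]
      _ ≤ b := (ENNReal.sum_le_tsum _).trans (hcost n).le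
  -- The tail is made smaller than `ε * x ^ 2` because the sets `D` will be priced two scales
  -- coarser, which multiplies the cost by `(x ^ 2)⁻¹`.
  obtain ⟨k₁, hk₁⟩ : ∃ k₁, ∑' k, (Nl (k + (k₁ + 2)) : ℝ≥0∞) * x ^ (k + (k₁ + 2)) < ε * x ^ 2 := by
    have h1 := ENNReal.tendsto_sum_nat_add (fun k => (Nl k : ℝ≥0∞) * x ^ k)
      (ne_top_of_le_ne_top hb hsum)
    have h2 : (0 : ℝ≥0∞) < ε * x ^ 2 := pos_iff_ne_zero.2 (mul_ne_zero hε (pow_ne_zero _ hx0))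
    obtain ⟨k₁, hk₁⟩ := ((h1.comp (tendsto_add_atTop_nat 2)).eventually (gt_mem_nhds h2)).exists
    exact ⟨k₁, hk₁⟩
  set k₀ := k₁ + 2 with hk₀
  have hdich := fun k i => exists_superset_or_wandering (fun n => E n k i) (fun n => hE n k i)
  have hD : ∀ k i, ∃ D : Set Z, ediam D ≤ 4 * 2⁻¹ ^ k ∧
      ((∀ᶠ n in (hyperfilter ℕ : Filter ℕ), E n k i ⊆ D) ∨
        ∀ m, ∀ᶠ n in (hyperfilter ℕ : Filter ℕ), Disjoint (E m k i) (E n k i)) := by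
    intro k i
    rcases hdich k i with ⟨D, h1, h2⟩ | h
    · exact ⟨D, h1, Or.inl h2⟩
    · exact ⟨∅, by simp, Or.inr h⟩
  choose D hDdiam hDcase using hD
  -- Coarse pieces are replaced by their Kuratowski limits, with no loss of diameter; fine pieces,
  -- in `B₂`, by the larger sets `D`, whose total cost is at most `ε`.
  let B₁ : Set Z := ⋃ k, ⋃ i < Nl k, if k < k₀ then ultraLimit (fun n => E n k i) else ∅
  let B₂ : Set Z := ⋃ k, ⋃ i < (if k₁ ≤ k then Nl (k + 2) else 0), D (k + 2) i
  have hB₁ : dyadicContent x B₁ ≤ b := by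
    refine (dyadicContent_le Nl _ (fun k i => ?_) subset_rfl).trans hsum
    split_ifs
    · exact ediam_ultraLimit_le _ fun n => hE n k i
    · simp
  have hB₂ : dyadicContent x B₂ ≤ ε := by
    refine (dyadicContent_le _ (fun k i => D (k + 2) i) (fun k i => ?_) subset_rfl).trans ?_
    · refine (hDdiam (k + 2) i).trans (le_of_eq ?_)
      rw [pow_add, mul_comm ((2 : ℝ≥0∞)⁻¹ ^ k), ← mul_assoc]
      have : (4 : ℝ≥0∞) * 2⁻¹ ^ 2 = 1 := by
        rw [← ENNReal.inv_pow, show (4 : ℝ≥0∞) = 2 ^ 2 by norm_num]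
        exact ENNReal.mul_inv_cancel (by simp) (by simp)
      rw [this, one_mul]
    · have h0 : x ^ 2 ≠ 0 := pow_ne_zero _ hx0
      have htop : x ^ 2 ≠ ⊤ := ENNReal.pow_ne_top hxtop
      refine (ENNReal.mul_le_mul_iff_left h0 htop).1 (le_trans (le_of_eq ?_) hk₁.le)
      rw [← ENNReal.tsum_mul_right, ENNReal.tsum_eq_tsum_add_of_eq_zero k₁]
      · refine tsum_congr fun k => ?_
        rw [if_pos (Nat.le_add_left _ _), mul_assoc, ← pow_add, add_assoc]
      · intro k hk
        rw [if_neg (by omega)]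
        simp
  refine ⟨B₁ ∪ B₂, (dyadicContent_union_le _ _ _).trans (add_le_add hB₁ hB₂), ?_⟩
  have hB₁mem : ∀ z k i, k < k₀ → i < Nl k → z ∉ B₁ → z ∉ ultraLimit fun n => E n k i := by
    intro z k i hk hi hz hcon
    refine hz (mem_iUnion.2 ⟨k, mem_iUnion.2 ⟨i, mem_iUnion.2 ⟨hi, ?_⟩⟩⟩)
    rwa [if_pos hk]
  have hB₂mem : ∀ z k i, k₀ ≤ k → i < Nl k → z ∉ B₂ → z ∉ D k i := by
    intro z k i hk hi hz hcon
    obtain ⟨j, rfl⟩ := Nat.exists_eq_add_of_le' ((Nat.le_add_left 2 k₁).trans hk)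
    refine hz (mem_iUnion.2 ⟨j, mem_iUnion.2 ⟨i, mem_iUnion.2 ⟨?_, hcon⟩⟩⟩)
    rwa [if_pos (by omega)]
  -- A point outside `B₁` has a basic neighbourhood missing all coarse pieces for most `n`. A
  -- countable basis reduces the dimension bound to countably many pieces `A m ∩ U`.
  let Good : Set (Set Z) := {b ∈ TopologicalSpace.countableBasis Z |
    ∀ᶠ n in (hyperfilter ℕ : Filter ℕ), ∀ k < k₀, ∀ i < Nl k, Disjoint b (E n k i)}
  have hGc : Good.Countable := (TopologicalSpace.countable_countableBasis Z).mono fun _ h => h.1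
  have hsub : (⋃ n, A n) \ (B₁ ∪ B₂) ⊆ ⋃ m, ⋃ U ∈ Good, (A m ∩ U) \ (B₁ ∪ B₂) := by
    rintro z ⟨hz, hzB⟩
    obtain ⟨m, hm⟩ := mem_iUnion.1 hz
    have hz1 : z ∉ B₁ := fun h => hzB (Or.inl h)
    have h1 : ∀ k i, k < k₀ → i < Nl k → ∃ V ∈ 𝓝 z,
        ∀ᶠ n in (hyperfilter ℕ : Filter ℕ), Disjoint V (E n k i) := fun k i hk hi =>
      exists_nhds_disjoint_of_notMem_ultraLimit (hB₁mem z k i hk hi hz1)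
    choose! V hV hVd using h1
    have hW : (⋂ k ∈ Finset.range k₀, ⋂ i ∈ Finset.range (Nl k), V k i) ∈ 𝓝 z := by
      rw [Filter.biInter_finset_mem]
      intro k hk
      rw [Filter.biInter_finset_mem]
      exact fun i hi => hV k i (Finset.mem_range.1 hk) (Finset.mem_range.1 hi)
    obtain ⟨U, hU, hzU, hUV⟩ :=
      (TopologicalSpace.isBasis_countableBasis Z).mem_nhds_iff.1 hW
    have hUgood : U ∈ Good := by
      refine ⟨hU, ?_⟩
      have h2 : ∀ᶠ n in (hyperfilter ℕ : Filter ℕ), ∀ k ∈ Finset.range k₀,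
          ∀ i ∈ Finset.range (Nl k), Disjoint (V k i) (E n k i) := by
        rw [Filter.eventually_all_finset]
        intro k hk
        rw [Filter.eventually_all_finset]
        exact fun i hi => hVd k i (Finset.mem_range.1 hk) (Finset.mem_range.1 hi)
      filter_upwards [h2] with n hn k hk i hi
      have hk' := Finset.mem_range.2 hk
      have hi' := Finset.mem_range.2 hi
      exact (hn k hk' i hi').mono_left (hUV.trans ((iInter₂_subset k hk').trans
        (iInter₂_subset i hi')))
    exact mem_iUnion.2 ⟨m, mem_iUnion₂.2 ⟨U, hUgood, ⟨hm, hzU⟩, hzB⟩⟩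
  refine (dimH_mono hsub).trans ?_
  rw [dimH_iUnion]
  refine iSup_le fun m => ?_
  rw [dimH_bUnion hGc]
  refine iSup₂_le fun U hU => ?_
  by_contra! hlt
  obtain ⟨s, hts, hs⟩ := ENNReal.lt_iff_exists_nnreal_btwn.1 hlt
  refine absurd (dimH_le_of_dyadicContent_eq_zero (ht.trans (by exact_mod_cast hts)) ?_)
    (not_le.2 hs)
  have hts' : (t : ℝ) < s := by exact_mod_cast hts
  obtain ⟨u, htu, hus⟩ := exists_between hts'
  set y : ℝ≥0∞ := (2 : ℝ≥0∞) ^ (-(s : ℝ))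
  set x' : ℝ≥0∞ := (2 : ℝ≥0∞) ^ (-u)
  have hy0 : y ≠ 0 := ENNReal.two_rpow_ne_zero _
  have hyx' : y < x' := ENNReal.rpow_lt_rpow_of_exponent_lt (by norm_num) (by simp) (by linarith)
  have hx'x : x' < x := ENNReal.rpow_lt_rpow_of_exponent_lt (by norm_num) (by simp) (by linarith)
  have hx'0 : x' ≠ 0 := ENNReal.two_rpow_ne_zero _
  -- In this piece, sets at scales below `k₀` miss `U`, and a set at a scale in `[k₀, K)` that
  -- contains a point outside `B₂` is not inside its `D`, so its index wanders. Letting `K → ∞`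
  -- makes the content vanish for every exponent `s > t`.
  have hbound : ∀ K, k₀ ≤ K → (1 - y / x') / 2 * dyadicContent y ((A m ∩ U) \ (B₁ ∪ B₂)) ≤
      2 * b * x'⁻¹ * (x' / x) ^ K := by
    intro K hK
    refine dyadicContent_le_of_wandering hy0 hyx' hx'x hxtop N E hE (fun n => (hcost n).le) Nl K
      (by omega) ?_
    have hcase : ∀ᶠ n in (hyperfilter ℕ : Filter ℕ), ∀ k ∈ Finset.range K,
        ∀ i ∈ Finset.range (Nl k), E n k i ⊆ D k i ∨
          ∀ m, ∀ᶠ n in (hyperfilter ℕ : Filter ℕ), Disjoint (E m k i) (E n k i) := by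
      rw [Filter.eventually_all_finset]
      intro k _
      rw [Filter.eventually_all_finset]
      intro i _
      rcases hDcase k i with h | h
      · filter_upwards [h] with n hn using Or.inl hn
      · exact Eventually.of_forall fun n => Or.inr h
    have hge : ∀ᶠ n in (hyperfilter ℕ : Filter ℕ), m ≤ n :=
      Nat.hyperfilter_le_atTop (eventually_ge_atTop m)
    filter_upwards [hcase, hge, hU.2, hNlK K] with n hn hmn hUn hNn
    rintro z ⟨⟨hzA, hzU⟩, hzB⟩
    have h1 := hcov n (hA hmn hzA)
    simp only [mem_iUnion, exists_prop] at h1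
    obtain ⟨k, i, hi, hz⟩ := h1
    refine ⟨k, i, hi, hz, fun hk => ?_⟩
    rw [hNn k hk] at hi
    refine ⟨hi, ?_⟩
    have hkk : k₀ ≤ k := by
      by_contra! hlt
      exact Set.disjoint_left.1 (hUn k hlt i hi) hzU hz
    rcases hn k (Finset.mem_range.2 hk) i (Finset.mem_range.2 hi) with h | h
    · exact absurd (h hz) (hB₂mem z k i hkk hi fun h => hzB (Or.inr h))
    · exact h
  have hq : x' / x < 1 := by
    rw [ENNReal.div_lt_iff (Or.inl hx0) (Or.inl hxtop), one_mul]; exact hx'x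
  have hlim : Tendsto (fun K : ℕ => 2 * b * x'⁻¹ * (x' / x) ^ K) atTop (𝓝 0) := by
    have := ENNReal.Tendsto.const_mul (a := 2 * b * x'⁻¹)
      (ENNReal.tendsto_pow_atTop_nhds_zero_of_lt_one hq) (Or.inr (by finiteness))
    simpa using this
  have hzero := ge_of_tendsto hlim ((eventually_ge_atTop k₀).mono hbound)
  have hne : (1 - y / x') / 2 ≠ 0 := by
    refine ENNReal.div_ne_zero.2 ⟨(tsub_pos_of_lt ?_).ne', by simp⟩
    rw [ENNReal.div_lt_iff (Or.inl hx'0) (Or.inl (hx'x.trans_le le_top).ne), one_mul]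
    exact hyx'
  exact (mul_eq_zero.1 (nonpos_iff_eq_zero.1 hzero)).resolve_left hne

/-- The `t`-dimensional dyadic content, computed modulo sets of dimension at most `t`. -/
noncomputable def dyadicContentMod [MetricSpace Z] (t : ℝ≥0) (A : Set Z) : ℝ≥0∞ :=
  ⨅ (S : Set Z) (_ : dimH S ≤ t), dyadicContent ((2 : ℝ≥0∞) ^ (-(t : ℝ))) (A \ S)

theorem dyadicContentMod_le [MetricSpace Z] {t : ℝ≥0} {A S : Set Z} (hS : dimH S ≤ t) :
    dyadicContentMod t A ≤ dyadicContent ((2 : ℝ≥0∞) ^ (-(t : ℝ))) (A \ S) :=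
  iInf₂_le S hS

theorem dyadicContentMod_le_dyadicContent [MetricSpace Z] (t : ℝ≥0) (A : Set Z) :
    dyadicContentMod t A ≤ dyadicContent ((2 : ℝ≥0∞) ^ (-(t : ℝ))) A := by
  simpa using dyadicContentMod_le (A := A) (S := ∅) (t := t) (by simp)

/-- Removing the union of all exceptional sets at once is harmless, because dimension is countably
stable. No measurability of the `A n` is needed, which is what Choquet's argument requires. -/
theorem dyadicContentMod_iUnion_le [MetricSpace Z] [SecondCountableTopology Z] {t : ℝ≥0}
    (ht : 0 < t) (A : ℕ → Set Z) (hA : Monotone A) {a : ℝ≥0∞}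
    (h : ∀ n, dyadicContentMod t (A n) ≤ a) : dyadicContentMod t (⋃ n, A n) ≤ a := by
  refine ENNReal.le_of_forall_pos_le_add fun ε hε ha => ?_
  have hε2 : (ε / 2 : ℝ≥0∞) ≠ 0 := by simpa using hε.ne'
  have h1 : ∀ n, ∃ S : Set Z, dimH S ≤ t ∧
      dyadicContent ((2 : ℝ≥0∞) ^ (-(t : ℝ))) (A n \ S) < a + ε / 2 := by
    intro n
    have := (h n).trans_lt (ENNReal.lt_add_right ha.ne hε2)
    simpa only [dyadicContentMod, iInf_lt_iff, exists_prop] using this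
  choose S hS hSc using h1
  obtain ⟨B, hB, hBd⟩ := exists_dyadicContent_le_dimH_diff_le ht (fun n => A n \ ⋃ m, S m)
    (fun m n hmn => sdiff_subset_sdiff_left (hA hmn)) (b := a + ε / 2) (ε := ε / 2)
    (ENNReal.add_ne_top.2 ⟨ha.ne, by finiteness⟩) hε2
    (fun n => (dyadicContent_mono (sdiff_subset_sdiff_right (subset_iUnion S n))).trans_lt (hSc n))
  have hdim : dimH ((⋃ m, S m) ∪ ((⋃ n, A n \ ⋃ m, S m) \ B)) ≤ t := by
    rw [dimH_union, dimH_iUnion]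
    exact max_le (iSup_le hS) hBd
  calc dyadicContentMod t (⋃ n, A n) ≤ _ := dyadicContentMod_le hdim
    _ ≤ dyadicContent ((2 : ℝ≥0∞) ^ (-(t : ℝ))) B := by
      refine dyadicContent_mono ?_
      rintro z ⟨hz, hzn⟩
      by_contra hzB
      refine hzn (or_iff_not_imp_left.2 fun hzS => ⟨?_, hzB⟩)
      obtain ⟨n, hn⟩ := mem_iUnion.1 hz
      exact mem_iUnion.2 ⟨n, hn, hzS⟩
    _ ≤ a + ε / 2 + ε / 2 := hB
    _ = a + ε := by rw [add_assoc, ENNReal.add_halves]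

/-- Otherwise a countable union of exceptional sets could be removed to leave content zero, forcing
`dimH A ≤ t`. -/
theorem dyadicContentMod_pos [MetricSpace Z] {t : ℝ≥0} (ht : 0 < t) {A : Set Z}
    (hA : (t : ℝ≥0∞) < dimH A) : 0 < dyadicContentMod t A := by
  rw [pos_iff_ne_zero]
  intro h0
  have h1 : ∀ n : ℕ, ∃ S : Set Z, dimH S ≤ t ∧
      dyadicContent ((2 : ℝ≥0∞) ^ (-(t : ℝ))) (A \ S) < (n : ℝ≥0∞)⁻¹ := by
    intro n
    have : dyadicContentMod t A < (n : ℝ≥0∞)⁻¹ := by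
      rw [h0]; exact ENNReal.inv_pos.2 (ENNReal.natCast_ne_top n)
    simpa only [dyadicContentMod, iInf_lt_iff, exists_prop] using this
  choose S hS hSc using h1
  have h2 : dyadicContent ((2 : ℝ≥0∞) ^ (-(t : ℝ))) (A \ ⋃ n, S n) = 0 := by
    refine nonpos_iff_eq_zero.1 (ge_of_tendsto' ENNReal.tendsto_inv_nat_nhds_zero fun n => ?_)
    exact (dyadicContent_mono (sdiff_subset_sdiff_right (subset_iUnion S n))).trans (hSc n).le
  have h3 := dimH_le_of_dyadicContent_eq_zero ht h2
  refine absurd hA (not_lt.2 ?_)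
  calc dimH A ≤ dimH ((A \ ⋃ n, S n) ∪ ⋃ n, S n) := dimH_mono (by simp)
    _ ≤ t := by
      rw [dimH_union, dimH_iUnion]
      exact max_le h3 (iSup_le hS)

end Increasing

/-! ### Duality between fractional coverings and measures. -/

section Frostman

open CompactlySupported CompactlySupportedContinuousMap

variable {K I : Type*}

/-- The cost of the cheapest fractional covering by the sets `U p`, with prices `c p`, that lies
above `f`. -/
noncomputable def fractionalCost (U : I → Set K) (c : I → ℝ) (f : K → ℝ) : ℝ :=
  sInf {r | ∃ w : I →₀ ℝ, (∀ p, 0 ≤ w p) ∧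
    (∀ z, f z ≤ Finsupp.linearCombination ℝ (fun p => (U p).indicator (1 : K → ℝ) z) w) ∧
    Finsupp.linearCombination ℝ c w = r}

theorem linearCombination_nonneg {c : I → ℝ} (hc : ∀ p, 0 ≤ c p) {w : I →₀ ℝ}
    (hw : ∀ p, 0 ≤ w p) : 0 ≤ Finsupp.linearCombination ℝ c w := by
  rw [Finsupp.linearCombination_apply]
  exact Finset.sum_nonneg fun p _ => mul_nonneg (hw p) (hc p)

theorem fractionalCost_le {U : I → Set K} {c : I → ℝ} (hc : ∀ p, 0 ≤ c p) {f : K → ℝ}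
    {w : I →₀ ℝ} (hw : ∀ p, 0 ≤ w p)
    (hf : ∀ z, f z ≤ Finsupp.linearCombination ℝ (fun p => (U p).indicator (1 : K → ℝ) z) w) :
    fractionalCost U c f ≤ Finsupp.linearCombination ℝ c w := by
  refine csInf_le ⟨0, ?_⟩ ⟨w, hw, hf, rfl⟩
  rintro _ ⟨v, hv, _, rfl⟩
  exact linearCombination_nonneg hc hv

theorem fractionalCost_nonneg (U : I → Set K) {c : I → ℝ} (hc : ∀ p, 0 ≤ c p) (f : K → ℝ) :
    0 ≤ fractionalCost U c f := by
  refine Real.sInf_nonneg ?_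
  rintro _ ⟨v, hv, _, rfl⟩
  exact linearCombination_nonneg hc hv

/-- Guarantees that the infimum in `fractionalCost` is over a nonempty set; the real `sInf` of the
empty set would be `0`. -/
theorem exists_fractional_cover [TopologicalSpace K] [CompactSpace K] {U : I → Set K}
    (hU : ∀ p, IsOpen (U p)) (hcov : ⋃ p, U p = univ) {f : K → ℝ} (hf : Continuous f) :
    ∃ w : I →₀ ℝ, (∀ p, 0 ≤ w p) ∧
      ∀ z, f z ≤ Finsupp.linearCombination ℝ (fun p => (U p).indicator (1 : K → ℝ) z) w := by
  classical
  obtain ⟨s, hs⟩ := isCompact_univ.elim_finite_subcover U hU hcov.ge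
  obtain ⟨M, hM⟩ := isCompact_univ.bddAbove_image hf.continuousOn
  have hM' : ∀ z, f z ≤ max M 0 := fun z =>
    (hM (mem_image_of_mem f (mem_univ z))).trans (le_max_left _ _)
  have hnn : ∀ p, 0 ≤ (Finsupp.onFinset s (fun p => if p ∈ s then max M 0 else 0)
      (fun p h => by by_contra hp; simp [hp] at h) : I →₀ ℝ) p := by
    intro p
    simp only [Finsupp.onFinset_apply]
    split_ifs
    · exact le_max_right _ _
    · exact le_rfl
  refine ⟨_, hnn, fun z => ?_⟩
  obtain ⟨p, hp, hzp⟩ := mem_iUnion₂.1 (hs (mem_univ z))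
  rw [Finsupp.linearCombination_apply,
    Finsupp.sum_of_support_subset _ Finsupp.support_onFinset_subset _ (by simp)]
  refine (hM' z).trans ?_
  have := Finset.single_le_sum (f := fun p => (Finsupp.onFinset s
      (fun p => if p ∈ s then max M 0 else 0) (fun p h => by by_contra hp; simp [hp] at h) :
        I →₀ ℝ) p • (U p).indicator (1 : K → ℝ) z)
    (fun q _ => mul_nonneg (hnn q) (indicator_nonneg (fun _ _ => zero_le_one) z)) hp
  refine le_trans (le_of_eq ?_) this
  simp [hp, hzp]

theorem le_fractionalCost [TopologicalSpace K] [CompactSpace K] {U : I → Set K} {c : I → ℝ}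
    (hU : ∀ p, IsOpen (U p)) (hcov : ⋃ p, U p = univ) {f : K → ℝ} (hf : Continuous f) {b : ℝ}
    (h : ∀ w : I →₀ ℝ, (∀ p, 0 ≤ w p) →
      (∀ z, f z ≤ Finsupp.linearCombination ℝ (fun p => (U p).indicator (1 : K → ℝ) z) w) →
      b ≤ Finsupp.linearCombination ℝ c w) : b ≤ fractionalCost U c f := by
  obtain ⟨w, hw, hwf⟩ := exists_fractional_cover hU hcov hf
  refine le_csInf ⟨_, w, hw, hwf, rfl⟩ ?_
  rintro _ ⟨v, hv, hvf, rfl⟩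
  exact h v hv hvf

theorem fractionalCost_add_le [TopologicalSpace K] [CompactSpace K] {U : I → Set K} {c : I → ℝ}
    (hU : ∀ p, IsOpen (U p)) (hcov : ⋃ p, U p = univ) (hc : ∀ p, 0 ≤ c p) {f g : K → ℝ}
    (hf : Continuous f) (hg : Continuous g) :
    fractionalCost U c (fun z => f z + g z) ≤ fractionalCost U c f + fractionalCost U c g := by
  rw [← sub_le_iff_le_add]
  refine le_fractionalCost hU hcov hf fun v hv hvf => ?_
  rw [sub_le_iff_le_add, ← sub_le_iff_le_add']
  refine le_fractionalCost hU hcov hg fun w hw hwg => ?_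
  rw [sub_le_iff_le_add', ← map_add]
  refine fractionalCost_le hc (fun p => add_nonneg (hv p) (hw p)) fun z => ?_
  rw [map_add]
  exact add_le_add (hvf z) (hwg z)

theorem fractionalCost_mul_le [TopologicalSpace K] [CompactSpace K] {U : I → Set K} {c : I → ℝ}
    (hU : ∀ p, IsOpen (U p)) (hcov : ⋃ p, U p = univ) (hc : ∀ p, 0 ≤ c p) {f : K → ℝ}
    (hf : Continuous f) {a : ℝ} (ha : 0 < a) :
    fractionalCost U c (fun z => a * f z) ≤ a * fractionalCost U c f := by
  rw [← div_le_iff₀' ha]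
  refine le_fractionalCost hU hcov hf fun v hv hvf => ?_
  rw [div_le_iff₀' ha, ← smul_eq_mul, ← map_smul]
  refine fractionalCost_le hc (fun p => mul_nonneg ha.le (hv p)) fun z => ?_
  rw [map_smul]
  exact mul_le_mul_of_nonneg_left (hvf z) ha.le

theorem fractionalCost_mul [TopologicalSpace K] [CompactSpace K] {U : I → Set K} {c : I → ℝ}
    (hU : ∀ p, IsOpen (U p)) (hcov : ⋃ p, U p = univ) (hc : ∀ p, 0 ≤ c p) {f : K → ℝ}
    (hf : Continuous f) {a : ℝ} (ha : 0 < a) :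
    fractionalCost U c (fun z => a * f z) = a * fractionalCost U c f := by
  refine le_antisymm (fractionalCost_mul_le hU hcov hc hf ha) ?_
  have := fractionalCost_mul_le hU hcov hc (f := fun z => a * f z) (continuous_const.mul hf)
    (inv_pos.2 ha)
  simp only [inv_mul_cancel_left₀ ha.ne'] at this
  rwa [← div_eq_inv_mul, le_div_iff₀' ha] at this

/-- Duality between fractional coverings and measures on a compact space: if no fractional covering
by the open sets `U p` with prices `c p` costs less than `b > 0`, then there is a nonzero measure
that gives each `U p` at most the mass `c p`. -/
theorem exists_measure_le_of_fractional_covers [TopologicalSpace K] [T2Space K] [CompactSpace K]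
    [MeasurableSpace K] [BorelSpace K] {U : I → Set K} {c : I → ℝ} (hU : ∀ p, IsOpen (U p))
    (hcov : ⋃ p, U p = univ) (hc : ∀ p, 0 ≤ c p) {b : ℝ} (hb : 0 < b)
    (h : ∀ w : I →₀ ℝ, (∀ p, 0 ≤ w p) →
      (∀ z, 1 ≤ Finsupp.linearCombination ℝ (fun p => (U p).indicator (1 : K → ℝ) z) w) →
      b ≤ Finsupp.linearCombination ℝ c w) :
    ∃ μ : Measure K, IsFiniteMeasure μ ∧ μ ≠ 0 ∧ ∀ p, μ (U p) ≤ ENNReal.ofReal (c p) := by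
  have hne : Nonempty K := by
    by_contra hK
    rw [not_nonempty_iff] at hK
    have := h 0 (fun _ => le_rfl) (fun z => (hK.false z).elim)
    simp at this
    linarith
  let one : C_c(K, ℝ) := continuousMapEquiv (1 : C(K, ℝ))
  have hone : ∀ z, one z = 1 := fun z => rfl
  have hone0 : one ≠ 0 := fun h0 => by
    obtain ⟨z⟩ := hne
    have := DFunLike.congr_fun h0 z
    rw [hone] at this
    simp at this
  let N : C_c(K, ℝ) → ℝ := fun f => fractionalCost U c f
  have hN1 : b ≤ N one := le_fractionalCost hU hcov one.continuous fun w hw hw1 => h w hw hw1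
  have hNmul : ∀ a : ℝ, 0 < a → ∀ f, N (a • f) = a * N f := fun a ha f =>
    fractionalCost_mul hU hcov hc f.continuous ha
  -- Hahn-Banach: the cost is sublinear and dominates `a • one ↦ a * b`, by `hN1` for `a > 0` and by
  -- nonnegativity of the cost otherwise.
  obtain ⟨L, hL1, hLN⟩ := exists_extension_of_le_sublinear
    (LinearPMap.mkSpanSingleton one b hone0) N hNmul
    (fun f g => fractionalCost_add_le hU hcov hc f.continuous g.continuous) (by
      rintro ⟨f, hf⟩
      obtain ⟨a, rfl⟩ := Submodule.mem_span_singleton.1 hf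
      rw [LinearPMap.mkSpanSingleton'_apply]
      rcases le_or_gt a 0 with ha | ha
      · exact (mul_nonpos_of_nonpos_of_nonneg ha hb.le).trans (fractionalCost_nonneg U hc _)
      · rw [hNmul a ha]
        exact mul_le_mul_of_nonneg_left hN1 ha.le)
  have hLone : L one = b :=
    (hL1 ⟨one, Submodule.mem_span_singleton_self one⟩).trans
      (LinearPMap.mkSpanSingleton_apply ℝ ℝ hone0 b)
  -- If `f ≥ 0`, the zero weights cover `-f` for free, so `L (-f) ≤ 0`.
  have hLpos : ∀ f : C_c(K, ℝ), 0 ≤ f → 0 ≤ L f := by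
    intro f hf
    have h1 : N (-f) ≤ 0 := by
      have := fractionalCost_le (U := U) hc (f := ⇑(-f)) (w := 0) (fun _ => le_rfl) (fun z => by
        simpa using hf z)
      simpa [N] using this
    have h2 := hLN (-f)
    rw [map_neg] at h2
    linarith
  let Λ : C_c(K, ℝ) →ₚ[ℝ] ℝ := PositiveLinearMap.mk₀ L hLpos
  have hΛ : ∀ f, Λ f = L f := fun f => rfl
  refine ⟨RealRMK.rieszMeasure Λ, inferInstance, fun h0 => ?_, fun p => ?_⟩
  · have h1 := RealRMK.integral_rieszMeasure Λ one
    rw [h0, hΛ, hLone] at h1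
    simp at h1
    linarith
  -- By inner regularity, test against Urysohn functions supported in `U p`; weight one on `p` alone
  -- covers them at price `c p`.
  · rw [(hU p).measure_eq_iSup_isCompact]
    refine iSup₂_le fun C hCU => iSup_le fun hC => ?_
    obtain ⟨f, hf1, hf2, hf3⟩ := exists_tsupport_one_of_isOpen_isClosed (hU p)
      isClosed_closure.isCompact hC.isClosed hCU
    let g : C_c(K, ℝ) := continuousMapEquiv f
    have hg : ∀ z, g z = f z := fun z => rfl
    refine (RealRMK.rieszMeasure_le_of_eq_one Λ (f := g) (fun z => (hf3 z).1) hC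
      (fun z hz => hf2 hz)).trans (ENNReal.ofReal_le_ofReal ?_)
    rw [hΛ]
    refine (hLN g).trans ?_
    have := fractionalCost_le (U := U) hc (f := ⇑g) (w := Finsupp.single p 1)
      (fun q => by
        classical
        rw [Finsupp.single_apply]
        split_ifs <;> norm_num) (fun z => by
        rw [Finsupp.linearCombination_single, one_smul, hg]
        by_cases hz : z ∈ U p
        · simpa [hz] using (hf3 z).2
        · have : z ∉ tsupport f := fun h => hz (hf1 h)
          simp [hz, image_eq_zero_of_notMem_tsupport this])
    simpa using this

end Frostman

/-! ### Choquet's argument and Frostman's lemma for analytic sets. -/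

section Analytic

variable {Z : Type*}

/-- The coordinates are bounded one at a time: `f '' C` is the increasing union of the sets `f '' (C
∩ {z | z k ≤ n})`, so some `n` keeps the content above `a`. -/
theorem exists_bound_forall_lt_dyadicContentMod [MetricSpace Z] [SecondCountableTopology Z]
    {t : ℝ≥0} (ht : 0 < t) (f : (ℕ → ℕ) → Z) {a : ℝ≥0∞} (ha : a < dyadicContentMod t (range f)) :
    ∃ σ : ℕ → ℕ, ∀ k, a < dyadicContentMod t (f '' {z | ∀ i < k, z i ≤ σ i}) := by
  have step : ∀ (k : ℕ) (C : {C : Set (ℕ → ℕ) // a < dyadicContentMod t (f '' C)}),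
      ∃ n, a < dyadicContentMod t (f '' (C.1 ∩ {z | z k ≤ n})) := by
    rintro k ⟨C, hC⟩
    by_contra! hcon
    refine absurd hC (not_lt.2 ?_)
    have hun : f '' C = ⋃ n, f '' (C ∩ {z | z k ≤ n}) := by
      rw [← image_iUnion, ← inter_iUnion]
      congr 1
      refine (inter_eq_left.2 fun z _ => mem_iUnion.2 ⟨z k, le_refl (z k)⟩).symm
    rw [hun]
    refine dyadicContentMod_iUnion_le ht _ (fun m n hmn => ?_) hcon
    exact image_mono (inter_subset_inter_right _ fun z (hz : z k ≤ m) => hz.trans hmn)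
  choose n hn using step
  let C : ℕ → {C : Set (ℕ → ℕ) // a < dyadicContentMod t (f '' C)} := fun k =>
    Nat.rec ⟨univ, by rwa [image_univ]⟩ (fun k C => ⟨C.1 ∩ {z | z k ≤ n k C}, hn k C⟩) k
  refine ⟨fun k => n k (C k), fun k => ?_⟩
  have hCk : ∀ k, (C k).1 = {z | ∀ i < k, z i ≤ n i (C i)} := by
    intro k
    induction k with
    | zero => simp [C]
    | succ k ih =>
      have : (C (k + 1)).1 = (C k).1 ∩ {z | z k ≤ n k (C k)} := rfl
      rw [this, ih]
      ext z
      simp only [mem_inter_iff, mem_ofPred_eq]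
      refine ⟨fun h i hi => ?_, fun h => ⟨fun i hi => h i (by omega), h k (by omega)⟩⟩
      rcases Nat.lt_succ_iff_lt_or_eq.1 hi with h' | rfl
      exacts [h.1 i h', h.2]
  rw [← hCk k]
  exact (C k).2

theorem isCompact_setOf_forall_le (σ : ℕ → ℕ) : IsCompact {z : ℕ → ℕ | ∀ i, z i ≤ σ i} := by
  have : {z : ℕ → ℕ | ∀ i, z i ≤ σ i} = Set.pi univ fun i => Set.Iic (σ i) := by
    ext z; simp [Pi.le_def]
  rw [this]
  exact isCompact_univ_pi fun i => (Set.finite_Iic (σ i)).isCompact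

/-- Points satisfying more and more of the constraints have truncations `min z σ` in a compact set.
A subsequential limit of the truncations is also a limit of the points, since each coordinate is
eventually untouched. -/
theorem exists_setOf_forall_lt_subset_of_isOpen (σ : ℕ → ℕ) {U : Set (ℕ → ℕ)} (hU : IsOpen U)
    (h : {z : ℕ → ℕ | ∀ i, z i ≤ σ i} ⊆ U) : ∃ k, {z : ℕ → ℕ | ∀ i < k, z i ≤ σ i} ⊆ U := by
  by_contra! hcon
  choose z hz hzU using fun k => not_subset.1 (hcon k)
  let y : ℕ → ℕ → ℕ := fun k i => min (z k i) (σ i)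
  obtain ⟨y₀, hy₀, φ, hφ, hlim⟩ := (isCompact_setOf_forall_le σ).tendsto_subseq (x := y)
    fun k i => min_le_right _ _
  have hz₀ : Tendsto (fun k => z (φ k)) atTop (𝓝 y₀) := by
    rw [tendsto_pi_nhds] at hlim ⊢
    intro i
    refine (hlim i).congr' ?_
    filter_upwards [eventually_gt_atTop i] with k hk
    exact min_eq_left (hz (φ k) i (hk.trans_le (hφ.id_le k)))
  obtain ⟨k, hk⟩ := (hz₀.eventually (hU.mem_nhds (h hy₀))).exists
  exact hzU (φ k) hk

theorem ENNReal.ofReal_inv_two_pow (k : ℕ) : ENNReal.ofReal ((2 : ℝ)⁻¹ ^ k) = (2 : ℝ≥0∞)⁻¹ ^ k := by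
  rw [ENNReal.ofReal_pow (by positivity), ENNReal.ofReal_inv_of_pos (by norm_num)]
  norm_num

/-- **Frostman's lemma** for analytic sets, with a loss in the exponent. -/
theorem exists_frostman_measure [MetricSpace Z] [SecondCountableTopology Z] [MeasurableSpace Z]
    [BorelSpace Z] {X : Set Z} (hX : AnalyticSet X) {s : ℝ≥0} (hs : (s : ℝ≥0∞) < dimH X) :
    ∃ K ⊆ X, ∃ μ : Measure K, IsFiniteMeasure μ ∧ μ ≠ 0 ∧
      ∀ (z : K) (k : ℕ), μ (ball z (2⁻¹ ^ (k + 2))) ≤ ((2 : ℝ≥0∞) ^ (-(s : ℝ))) ^ k := by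
  -- Room between `s` and `t` pays for rounding fractional coverings.
  obtain ⟨t, hst, htX⟩ := ENNReal.lt_iff_exists_nnreal_btwn.1 hs
  have hst' : (s : ℝ) < t := by exact_mod_cast hst
  have ht : 0 < t := lt_of_le_of_lt (zero_le (a := s)) (by exact_mod_cast hst)
  rw [AnalyticSet] at hX
  rcases hX with rfl | ⟨f, hf, rfl⟩
  · simp at hs
  obtain ⟨a, ha0, ha⟩ := exists_between (dyadicContentMod_pos ht htX)
  obtain ⟨σ, hσ⟩ := exists_bound_forall_lt_dyadicContentMod ht f ha
  set T : Set (ℕ → ℕ) := {z | ∀ i, z i ≤ σ i} with hT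
  have hK : IsCompact (f '' T) := (isCompact_setOf_forall_le σ).image hf
  have : CompactSpace (f '' T) := isCompact_iff_compactSpace.1 hK
  refine ⟨f '' T, image_subset_range _ _, ?_⟩
  set y : ℝ≥0∞ := (2 : ℝ≥0∞) ^ (-(t : ℝ)) with hy
  set x : ℝ≥0∞ := (2 : ℝ≥0∞) ^ (-(s : ℝ)) with hx
  have hy0 : y ≠ 0 := ENNReal.two_rpow_ne_zero _
  have hxtop : x ≠ ⊤ := ENNReal.two_rpow_ne_top _
  have hx0 : x ≠ 0 := ENNReal.two_rpow_ne_zero _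
  have hyx : y < x := ENNReal.rpow_lt_rpow_of_exponent_lt (by norm_num) (by simp) (by linarith)
  set θ : ℝ≥0∞ := (1 - y / x) / 2 with hθ
  have hθ0 : θ ≠ 0 := by
    refine ENNReal.div_ne_zero.2 ⟨(tsub_pos_of_lt ?_).ne', by simp⟩
    rw [ENNReal.div_lt_iff (Or.inl hx0) (Or.inl hxtop), one_mul]
    exact hyx
  have hθtop : θ ≠ ⊤ := ENNReal.div_ne_top (ENNReal.sub_ne_top ENNReal.one_ne_top) (by simp)
  have hatop : a ≠ ⊤ := (ha.trans_le le_top).ne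
  -- `θ` is the rounding loss; the factor `2⁻¹` comes from doubling weights that cover a
  -- neighbourhood only by one half.
  have hβ0 : 2⁻¹ * (θ * a) ≠ 0 := mul_ne_zero (by simp) (mul_ne_zero hθ0 ha0.ne')
  have hβtop : 2⁻¹ * (θ * a) ≠ ⊤ :=
    ENNReal.mul_ne_top (by simp) (ENNReal.mul_ne_top hθtop hatop)
  obtain ⟨μ, hμ, hμ0, hμU⟩ := exists_measure_le_of_fractional_covers (K := f '' T)
    (I := (f '' T : Set Z) × ℕ) (U := fun p => ball p.1 (2⁻¹ ^ (p.2 + 2)))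
    (c := fun p => x.toReal ^ p.2) (fun p => isOpen_ball)
    (eq_univ_of_forall fun z => mem_iUnion.2 ⟨(z, 0), mem_ball_self (by positivity)⟩)
    (fun p => by positivity) (b := (2⁻¹ * (θ * a)).toReal) (ENNReal.toReal_pos hβ0 hβtop) (by
      intro w hw hw1
      let V : (f '' T : Set Z) × ℕ → Set Z := fun p => ball (p.1 : Z) (2⁻¹ ^ (p.2 + 2))
      have hVU : ∀ p (z : f '' T), (ball p.1 (2⁻¹ ^ (p.2 + 2))).indicator
          (1 : (f '' T : Set Z) → ℝ) z = (V p).indicator (1 : Z → ℝ) z := fun p z => rfl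
      -- on the open set `W` the weights still cover by at least one half
      let W : Set Z := {z | (1 / 2 : ℝ) < ∑ p ∈ w.support, w p * (V p).indicator (1 : Z → ℝ) z}
      have hW : IsOpen W := by
        have hlsc : LowerSemicontinuous
            fun z => ∑ p ∈ w.support, w p * (V p).indicator (1 : Z → ℝ) z := by
          refine lowerSemicontinuous_sum fun p _ => ?_
          have h1 : (fun z => w p * (V p).indicator (1 : Z → ℝ) z) =
              (V p).indicator fun _ : Z => w p := by
            funext z
            by_cases hz : z ∈ V p <;> simp [hz]
          rw [h1]
          exact isOpen_ball.lowerSemicontinuous_indicator (hw p)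
        exact hlsc.isOpen_preimage (1 / 2)
      have hTW : T ⊆ f ⁻¹' W := by
        intro z hz
        have := hw1 ⟨f z, mem_image_of_mem f hz⟩
        rw [Finsupp.linearCombination_apply, Finsupp.sum] at this
        simp only [smul_eq_mul, hVU] at this
        simp only [W, mem_preimage, mem_ofPred_eq]
        linarith
      -- The content of the compact set itself is not controlled, but its open neighbourhood `W`
      -- contains the image of a cylinder, of content above `a`.
      obtain ⟨k, hk⟩ := exists_setOf_forall_lt_subset_of_isOpen σ (hW.preimage hf) hTW
      have hcont := ((hσ k).trans_le (dyadicContentMod_le_dyadicContent _ _)).trans_le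
        (dyadicContent_mono (image_subset_iff.2 hk))
      have hle := dyadicContent_le_of_weights (S := W) hy0 hyx hxtop
        (fun p : w.support => ENNReal.ofReal (2 * w p)) (fun p => p.1.2) (fun p => V p)
        (fun p _ => by
          change ediam (ball (p.1.1 : Z) _) ≤ _
          rw [← eball_ofReal, ENNReal.ofReal_inv_two_pow]
          refine ediam_eball_le.trans (le_of_eq ?_)
          rw [pow_succ' _ (p.1.2 + 1), ← mul_assoc, ENNReal.mul_inv_cancel (by simp) (by simp),
            one_mul]) (fun z hz => by
          rw [tsum_fintype, Finset.sum_coe_sort w.support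
            (fun p => (V p).indicator (fun _ => ENNReal.ofReal (2 * w p)) z)]
          have hz' : (1 : ℝ) ≤ ∑ p ∈ w.support, 2 * w p * (V p).indicator (1 : Z → ℝ) z := by
            simp only [W, mem_ofPred_eq] at hz
            simp only [mul_assoc, ← Finset.mul_sum]
            linarith
          rw [← ENNReal.ofReal_one]
          refine (ENNReal.ofReal_le_ofReal hz').trans (le_of_eq ?_)
          have hnn : ∀ p ∈ w.support, 0 ≤ 2 * w p * (V p).indicator (1 : Z → ℝ) z := fun p _ =>
            mul_nonneg (mul_nonneg zero_le_two (hw p)) (indicator_nonneg (fun _ _ => zero_le_one) z)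
          rw [ENNReal.ofReal_sum_of_nonneg hnn]
          refine Finset.sum_congr rfl fun p _ => ?_
          by_cases hzp : z ∈ V p <;> simp [hzp])
      have hcost : ∑' p : w.support, ENNReal.ofReal (2 * w p) * x ^ p.1.2 =
          2 * ENNReal.ofReal (Finsupp.linearCombination ℝ (fun p => x.toReal ^ p.2) w) := by
        have hnn : ∀ p ∈ w.support, 0 ≤ w p • x.toReal ^ p.2 := fun p _ =>
          mul_nonneg (hw p) (by positivity)
        rw [tsum_fintype, Finset.sum_coe_sort w.support
            (fun p => ENNReal.ofReal (2 * w p) * x ^ p.2), Finsupp.linearCombination_apply,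
          Finsupp.sum, ENNReal.ofReal_sum_of_nonneg hnn, Finset.mul_sum]
        refine Finset.sum_congr rfl fun p _ => ?_
        rw [smul_eq_mul, ENNReal.ofReal_mul zero_le_two, ENNReal.ofReal_mul (hw p),
          ENNReal.ofReal_pow ENNReal.toReal_nonneg, ENNReal.ofReal_toReal hxtop, mul_assoc]
        norm_num
      rw [hcost] at hle
      refine ENNReal.toReal_le_of_le_ofReal (linearCombination_nonneg (fun p => by positivity) hw) ?_
      rw [← ENNReal.div_eq_inv_mul]
      exact ENNReal.div_le_of_le_mul' ((mul_le_mul_right hcont.le θ).trans hle))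
  refine ⟨μ, hμ, hμ0, fun z k => (hμU (z, k)).trans (le_of_eq ?_)⟩
  rw [ENNReal.ofReal_pow ENNReal.toReal_nonneg, ENNReal.ofReal_toReal hxtop]

end Analytic

/-! ### Negative moments, energies and dimension of images. -/

section Energy

/-- The `1` handles `a ≥ 1`. For `0 < a < 1` the term with `2⁻¹ ^ (k + 1) ≤ a < 2⁻¹ ^ k` suffices.
At `a = 0` both sides are infinite. -/
theorem ENNReal.rpow_neg_le_one_add_tsum (a : ℝ≥0∞) {s : ℝ} (hs : 0 < s) :
    a ^ (-s) ≤ 1 + ∑' k : ℕ, (Set.Iio ((2 : ℝ≥0∞)⁻¹ ^ k)).indicator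
      (fun _ => (2 : ℝ≥0∞) ^ s * ((2 : ℝ≥0∞) ^ s) ^ k) a := by
  rcases le_or_gt 1 a with ha | ha
  · refine le_trans ?_ le_self_add
    rw [ENNReal.rpow_neg, ENNReal.inv_le_one]
    exact ENNReal.one_le_rpow ha hs
  refine le_trans ?_ le_add_self
  rcases eq_or_ne a 0 with rfl | ha0
  · refine le_trans le_top (le_of_eq ?_)
    rw [eq_comm, ← top_le_iff,
      ← ENNReal.tsum_const_eq_top_of_ne_zero (α := ℕ) (c := 1) one_ne_zero]
    refine ENNReal.tsum_le_tsum fun k => ?_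
    have h2 : (1 : ℝ≥0∞) ≤ 2 ^ s := ENNReal.one_le_rpow (by norm_num) hs
    rw [indicator_of_mem (mem_Iio.2 (pos_iff_ne_zero.2 (by simp)))]
    exact one_le_mul h2 (one_le_pow₀ h2)
  classical
  have hex : ∃ k : ℕ, (2 : ℝ≥0∞)⁻¹ ^ (k + 1) ≤ a := by
    obtain ⟨k, hk⟩ := ENNReal.exists_inv_two_pow_lt ha0
    exact ⟨k, (pow_le_pow_right_of_le_one' (by simp) (Nat.le_succ k)).trans hk.le⟩
  have hlt : a < 2⁻¹ ^ Nat.find hex := by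
    rcases Nat.eq_zero_or_pos (Nat.find hex) with h0 | h0
    · rw [h0, pow_zero]; exact ha
    · have := Nat.find_min hex (Nat.sub_lt h0 one_pos)
      rwa [Nat.sub_add_cancel (show 1 ≤ Nat.find hex from h0), not_le] at this
  refine le_trans ?_ (ENNReal.le_tsum (Nat.find hex))
  rw [indicator_of_mem (mem_Iio.2 hlt), ← pow_succ', ENNReal.rpow_neg, ENNReal.inv_le_iff_inv_le]
  refine le_trans (le_of_eq ?_) (ENNReal.rpow_le_rpow (Nat.find_spec hex) hs.le)
  rw [ENNReal.inv_two_pow_rpow, ENNReal.rpow_neg, ENNReal.inv_pow]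

/-- A power law for the distribution of `W` near `0` bounds the negative moments of `W`. -/
theorem lintegral_rpow_neg_le {Ω : Type*} [MeasurableSpace Ω] (ν : Measure Ω) {W : Ω → ℝ≥0∞}
    (hW : Measurable W) {s τ : ℝ} (hs : 0 < s) {C : ℝ≥0∞}
    (h : ∀ k : ℕ, ν {ω | W ω < 2⁻¹ ^ k} ≤ C * ((2 : ℝ≥0∞) ^ (-τ)) ^ k) :
    ∫⁻ ω, W ω ^ (-s) ∂ν ≤ ν univ + 2 ^ s * C * (1 - 2 ^ (s - τ))⁻¹ := by
  have hmeas : ∀ k : ℕ, MeasurableSet {ω | W ω < 2⁻¹ ^ k} := fun k => hW measurableSet_Iio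
  calc ∫⁻ ω, W ω ^ (-s) ∂ν
      ≤ ∫⁻ ω, (1 + ∑' k : ℕ, {ω | W ω < 2⁻¹ ^ k}.indicator
          (fun _ => (2 : ℝ≥0∞) ^ s * ((2 : ℝ≥0∞) ^ s) ^ k) ω) ∂ν :=
        lintegral_mono fun ω => ENNReal.rpow_neg_le_one_add_tsum (W ω) hs
    _ = ν univ + ∑' k : ℕ, (2 : ℝ≥0∞) ^ s * ((2 : ℝ≥0∞) ^ s) ^ k * ν {ω | W ω < 2⁻¹ ^ k} := by
        rw [lintegral_add_left measurable_const, lintegral_one, lintegral_tsum fun k =>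
          (measurable_const.indicator (hmeas k)).aemeasurable]
        congr 1
        exact tsum_congr fun k => lintegral_indicator_const (hmeas k) _
    _ ≤ ν univ + ∑' k : ℕ, 2 ^ s * C * ((2 : ℝ≥0∞) ^ (s - τ)) ^ k := by
        refine add_le_add_right (ENNReal.tsum_le_tsum fun k => ?_) _
        refine (mul_le_mul_right (h k) _).trans (le_of_eq ?_)
        rw [sub_eq_add_neg, ENNReal.rpow_add _ _ (by simp) (by simp), mul_pow]
        ring
    _ = _ := by rw [ENNReal.tsum_mul_left, ENNReal.tsum_geometric]

theorem lintegral_rpow_neg_bound_ne_top {s τ : ℝ} (hsτ : s < τ) {a C : ℝ≥0∞} (ha : a ≠ ⊤)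
    (hC : C ≠ ⊤) : a + 2 ^ s * C * (1 - 2 ^ (s - τ))⁻¹ ≠ ⊤ := by
  refine ENNReal.add_ne_top.2 ⟨ha, ENNReal.mul_ne_top
    (ENNReal.mul_ne_top (ENNReal.two_rpow_ne_top _) hC) (ENNReal.inv_ne_top.2 ?_)⟩
  refine (tsub_pos_of_lt ?_).ne'
  have := ENNReal.rpow_neg_lt_one (sub_pos.2 hsτ)
  rwa [neg_sub] at this

/-- The image of a nonzero measure with finite `s`-energy has dimension at least `s`. -/
theorem le_dimH_range_of_energy_ne_top {K Y : Type*} [MeasurableSpace K] {μ : Measure K}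
    [SFinite μ] (hμ : μ ≠ 0) [MetricSpace Y] [SecondCountableTopology Y] [MeasurableSpace Y]
    [BorelSpace Y] {g : K → Y} (hg : Measurable g) {s : ℝ≥0}
    (hE : ∫⁻ z, ∫⁻ y, edist (g z) (g y) ^ (-(s : ℝ)) ∂μ ∂μ ≠ ⊤) : (s : ℝ≥0∞) ≤ dimH (range g) := by
  have hF : Measurable fun p : K × K => edist (g p.1) (g p.2) ^ (-(s : ℝ)) :=
    ((hg.comp measurable_fst).edist (hg.comp measurable_snd)).pow_const _
  set h : K → ℝ≥0∞ := fun z => ∫⁻ y, edist (g z) (g y) ^ (-(s : ℝ)) ∂μ with hh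
  have hmeas : Measurable h := hF.lintegral_prod_right'
  -- The potential `h` is finite almost everywhere, hence bounded on a set of positive measure;
  -- Markov's inequality there gives the growth bound `hball`.
  obtain ⟨M, hM⟩ : ∃ M : ℕ, μ {z | h z ≤ M} ≠ 0 := by
    by_contra! hcon
    refine hμ (Measure.measure_univ_eq_zero.1 ?_)
    have h1 : μ (⋃ M : ℕ, {z | h z ≤ M}) = 0 := measure_iUnion_null hcon
    have h2 : ∀ᵐ z ∂μ, z ∈ ⋃ M : ℕ, {z | h z ≤ M} := by
      filter_upwards [ae_lt_top hmeas hE] with z hz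
      obtain ⟨M, hM⟩ := ENNReal.exists_nat_gt hz.ne
      exact mem_iUnion.2 ⟨M, hM.le⟩
    refine nonpos_iff_eq_zero.1 ((measure_mono_ae (t := ⋃ M : ℕ, {z | h z ≤ M}) ?_).trans h1.le)
    filter_upwards [h2] with z hz _ using hz
  set c : ℝ≥0∞ := M + 1 with hc
  have hc0 : c ≠ 0 := by simp [hc]
  have hctop : c ≠ ⊤ := by simp [hc]
  set B : Set K := {z | h z ≤ M} with hB
  have hball : ∀ z ∈ B, ∀ r : ℝ≥0∞, μ {y | edist (g z) (g y) ≤ r} ≤ c * r ^ (s : ℝ) := by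
    intro z hz r
    have h1 := mul_meas_ge_le_lintegral (μ := μ)
      (hF.comp (measurable_const.prodMk measurable_id) : Measurable fun y =>
        edist (g z) (g y) ^ (-(s : ℝ))) (r ^ (-(s : ℝ)))
    have h2 : μ {y | edist (g z) (g y) ≤ r} ≤
        μ {y | r ^ (-(s : ℝ)) ≤ edist (g z) (g y) ^ (-(s : ℝ))} := by
      refine measure_mono fun y (hy : edist (g z) (g y) ≤ r) => ?_
      simp only [mem_ofPred_eq, ENNReal.rpow_neg]
      exact ENNReal.inv_le_inv.2 (ENNReal.rpow_le_rpow hy s.2)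
    rw [← ENNReal.div_le_iff_le_mul (Or.inr hctop) (Or.inr hc0), ENNReal.div_eq_inv_mul,
      ← ENNReal.rpow_neg]
    calc _ ≤ _ := mul_le_mul_right h2 _
      _ ≤ h z := h1
      _ ≤ c := (show h z ≤ M from hz).trans le_self_add
  let ν : Measure Y := c⁻¹ • (μ.restrict B).map g
  have hν : ν ≤ μH[(s : ℝ)] := by
    refine Measure.le_hausdorffMeasure _ _ 1 one_pos fun t _ => ?_
    -- Closing `t` makes it measurable without changing its diameter.
    calc ν t ≤ ν (closure t) := measure_mono subset_closure
      _ = c⁻¹ * μ (g ⁻¹' closure t ∩ B) := by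
        rw [Measure.smul_apply, Measure.map_apply hg isClosed_closure.measurableSet,
          Measure.restrict_apply (hg isClosed_closure.measurableSet), smul_eq_mul]
      _ ≤ c⁻¹ * (c * ediam t ^ (s : ℝ)) := by
        gcongr
        rcases (g ⁻¹' closure t ∩ B).eq_empty_or_nonempty with he | ⟨z, hzt, hzB⟩
        · rw [he, measure_empty]; exact zero_le
        · refine (measure_mono fun y hy => ?_).trans (hball z hzB (ediam t))
          rw [← ediam_closure t]
          exact edist_le_ediam_of_mem hzt hy.1
      _ = ediam t ^ (s : ℝ) := by
        rw [← mul_assoc, ENNReal.inv_mul_cancel hc0 hctop, one_mul]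
  refine le_dimH_of_hausdorffMeasure_ne_zero fun h0 => hM ?_
  have h1 : ν (range g) = 0 := nonpos_iff_eq_zero.1 ((hν _).trans h0.le)
  rw [Measure.smul_apply, smul_eq_mul, mul_eq_zero] at h1
  have h2 := h1.resolve_left (ENNReal.inv_ne_zero.2 hctop)
  -- This inequality holds for all sets, so `range g` need not be measurable.
  have h3 := Measure.le_map_apply hg.aemeasurable (μ := μ.restrict B) (range g)
  rw [h2, preimage_range, Measure.restrict_apply_univ] at h3
  exact nonpos_iff_eq_zero.1 h3

/-- Transversality is a power law of exponent `κ` at `0` for the ratio `edist (π l x₁) (π l x₂) /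
edist x₁ x₂ ^ α`, whatever the points. The constant is finite when `s < κ` and `P` is finite. -/
theorem IsTransversal.lintegral_edist_rpow_neg_le {Λ X Y : Type*} [MeasurableSpace Λ]
    [MetricSpace X] [MetricSpace Y] [SecondCountableTopology Y] [MeasurableSpace Y] [BorelSpace Y]
    {P : Measure Λ} {π : Λ → X → Y} {α κ C : ℝ≥0} (h : IsTransversal P π α κ C)
    (hπ : ∀ x, Measurable fun l => π l x) {s : ℝ≥0} (hs : 0 < s) (hα : 0 < α) (x₁ x₂ : X) :
    ∫⁻ l, edist (π l x₁) (π l x₂) ^ (-(s : ℝ)) ∂P ≤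
      (P univ + 1 + 2 ^ (s : ℝ) * C * (1 - 2 ^ ((s : ℝ) - κ))⁻¹) *
        edist x₁ x₂ ^ (-((α * s : ℝ≥0) : ℝ)) := by
  rcases eq_or_ne x₁ x₂ with rfl | hne
  -- For equal points the right side is `⊤`; the summand `1` keeps the constant nonzero even if `P =
  -- 0`.
  · rw [edist_self, ENNReal.zero_rpow_of_neg (neg_lt_zero.2 (by positivity)), ENNReal.mul_top]
    · exact le_top
    · exact (zero_lt_one.trans_le (le_add_self.trans le_self_add)).ne'
  set e : ℝ≥0∞ := edist x₁ x₂ ^ (α : ℝ) with he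
  have he0 : e ≠ 0 := by
    simp [he, ENNReal.rpow_eq_zero_iff, edist_eq_zero, hne, edist_ne_top]
  have hetop : e ≠ ⊤ := ENNReal.rpow_ne_top_of_nonneg α.2 (edist_ne_top _ _)
  have hW : Measurable fun l => edist (π l x₁) (π l x₂) / e :=
    ((hπ x₁).edist (hπ x₂)).div_const e
  have hpow : ∀ l, edist (π l x₁) (π l x₂) ^ (-(s : ℝ)) =
      (edist (π l x₁) (π l x₂) / e) ^ (-(s : ℝ)) * edist x₁ x₂ ^ (-((α * s : ℝ≥0) : ℝ)) := by
    intro l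
    have h1 : edist x₁ x₂ ^ (-((α * s : ℝ≥0) : ℝ)) = e ^ (-(s : ℝ)) := by
      rw [he, ← ENNReal.rpow_mul]
      push_cast
      ring_nf
    rw [h1, ← ENNReal.mul_rpow_of_ne_top (ENNReal.div_ne_top (edist_ne_top _ _) he0) hetop,
      ENNReal.div_mul_cancel he0 hetop]
  simp_rw [hpow]
  rw [lintegral_mul_const _ (hW.pow_const _)]
  gcongr
  refine (lintegral_rpow_neg_le P hW (NNReal.coe_pos.2 hs) (C := C) (τ := κ) fun k => ?_).trans ?_
  · have hδ : (0 : ℝ) < 2⁻¹ ^ k := by positivity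
    refine (measure_mono fun l hl => ?_).trans ((h _ hδ x₁ x₂ hne).trans (le_of_eq ?_))
    · simp only [mem_ofPred_eq] at hl ⊢
      rw [ENNReal.div_lt_iff (Or.inl he0) (Or.inl hetop)] at hl
      rw [he, edist_dist, edist_dist, ENNReal.ofReal_rpow_of_nonneg dist_nonneg α.coe_nonneg,
        ← ENNReal.ofReal_inv_two_pow, ← ENNReal.ofReal_mul hδ.le] at hl
      exact ((ENNReal.ofReal_lt_ofReal_iff_of_nonneg dist_nonneg).1 hl).le
    · rw [ENNReal.ofReal_mul C.coe_nonneg, ENNReal.ofReal_coe_nnreal,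
        ← ENNReal.ofReal_rpow_of_nonneg hδ.le κ.coe_nonneg, ENNReal.ofReal_inv_two_pow,
        ENNReal.inv_two_pow_rpow]
  · exact add_le_add_left le_self_add _

end Energy

/-! ### Almost sure dimension bounds. -/

theorem IsTransversal.comp {Λ X X' Y : Type*} [MeasurableSpace Λ] [MetricSpace X] [MetricSpace X']
    [MetricSpace Y] {P : Measure Λ} {π : Λ → X → Y} {α κ C : ℝ≥0} (h : IsTransversal P π α κ C)
    {i : X' → X} (hi : Isometry i) : IsTransversal P (fun l x => π l (i x)) α κ C := by
  intro δ hδ x₁ x₂ hne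
  have := h δ hδ (i x₁) (i x₂) (hi.injective.ne hne)
  rwa [hi.dist_eq] at this

/-- A Frostman measure of exponent `u` has finite `v`-energy for `v < u`. -/
theorem lintegral_edist_rpow_neg_ne_top {K : Type*} [MetricSpace K] [SecondCountableTopology K]
    [MeasurableSpace K] [BorelSpace K] {μ : Measure K} [IsFiniteMeasure μ] {u v : ℝ} (hv : 0 < v)
    (hvu : v < u)
    (hμ : ∀ (z : K) (k : ℕ), μ (ball z (2⁻¹ ^ (k + 2))) ≤ ((2 : ℝ≥0∞) ^ (-u)) ^ k) :
    ∫⁻ z, ∫⁻ y, edist z y ^ (-v) ∂μ ∂μ ≠ ⊤ := by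
  set q : ℝ≥0∞ := (2 : ℝ≥0∞) ^ (-u) with hq
  have hq0 : q ≠ 0 := ENNReal.two_rpow_ne_zero _
  have hqtop : q ≠ ⊤ := ENNReal.two_rpow_ne_top _
  have hq1 : q ≤ 1 := (ENNReal.rpow_neg_lt_one (hv.trans hvu)).le
  have hq2 : (q ^ 2)⁻¹ * q ^ 2 = 1 :=
    ENNReal.inv_mul_cancel (pow_ne_zero _ hq0) (ENNReal.pow_ne_top hqtop)
  -- The factor `(q ^ 2)⁻¹` undoes the shift by two scales in `hμ`, and `μ univ` covers the scales
  -- `0` and `1`, where `hμ` says nothing.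
  set C : ℝ≥0∞ := (1 + μ univ) * (q ^ 2)⁻¹ with hC
  have hCtop : C ≠ ⊤ := ENNReal.mul_ne_top
    (ENNReal.add_ne_top.2 ⟨ENNReal.one_ne_top, measure_ne_top μ _⟩)
    (ENNReal.inv_ne_top.2 (pow_ne_zero _ hq0))
  have hball : ∀ (z : K) (k : ℕ), μ {y | edist z y < 2⁻¹ ^ k} ≤ C * q ^ k := by
    intro z k
    rcases lt_or_ge k 2 with hk | hk
    · calc μ {y | edist z y < 2⁻¹ ^ k} ≤ (1 + μ univ) * ((q ^ 2)⁻¹ * q ^ 2) := by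
            rw [hq2, mul_one]
            exact (measure_mono (subset_univ _)).trans le_add_self
        _ ≤ (1 + μ univ) * ((q ^ 2)⁻¹ * q ^ k) := by
            gcongr (1 + μ univ) * ((q ^ 2)⁻¹ * ?_)
            exact pow_le_pow_right_of_le_one' hq1 hk.le
        _ = C * q ^ k := by rw [hC, mul_assoc]
    · obtain ⟨j, rfl⟩ := Nat.exists_eq_add_of_le' hk
      have h1 : {y | edist z y < 2⁻¹ ^ (j + 2)} = ball z (2⁻¹ ^ (j + 2)) := by
        rw [← eball_ofReal, ENNReal.ofReal_inv_two_pow]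
        ext y
        rw [mem_eball, edist_comm]
        rfl
      rw [h1]
      calc μ (ball z (2⁻¹ ^ (j + 2))) ≤ 1 * q ^ j := by rw [one_mul]; exact hμ z j
        _ ≤ (1 + μ univ) * q ^ j := by gcongr; exact le_self_add
        _ = (1 + μ univ) * ((q ^ 2)⁻¹ * q ^ 2 * q ^ j) := by rw [hq2, one_mul]
        _ = C * q ^ (j + 2) := by rw [hC, pow_add]; ring
  have hbound := lintegral_rpow_neg_bound_ne_top hvu (measure_ne_top μ univ) hCtop
  refine ne_top_of_le_ne_top (ENNReal.mul_ne_top hbound (measure_ne_top μ univ))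
    (le_trans (lintegral_mono fun z =>
      lintegral_rpow_neg_le μ measurable_edist_right hv (hball z)) ?_)
  rw [lintegral_const]

/-- Apply Frostman with an exponent strictly between `α * s` and `dimH X`. By Tonelli the
`P`-integral of the `s`-energies of the images is at most `A` times the `α * s`-energy, so these
energies are finite almost surely. -/
theorem ae_le_dimH_range_of_isTransversal {Z Y Λ : Type*} [MetricSpace Z]
    [SecondCountableTopology Z] [MeasurableSpace Z] [BorelSpace Z]
    [MetricSpace Y] [SecondCountableTopology Y] [MeasurableSpace Y] [BorelSpace Y]
    [MeasurableSpace Λ] {P : Measure Λ} [IsFiniteMeasure P] {X : Set Z} (hX : AnalyticSet X)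
    {π : Λ → X → Y} (hπ : Measurable (fun p : Λ × X => π p.1 p.2)) {α κ C : ℝ≥0} (hα : 0 < α)
    (htrans : IsTransversal P π α κ C) {s : ℝ≥0} (hs : 0 < s) (hsκ : s < κ)
    (hsX : (α * s : ℝ≥0) < dimH X) : ∀ᵐ l ∂P, (s : ℝ≥0∞) ≤ dimH (range (π l)) := by
  obtain ⟨u, hu, huX⟩ := ENNReal.lt_iff_exists_nnreal_btwn.1 hsX
  obtain ⟨K, hKX, μ, hμ, hμ0, hμball⟩ := exists_frostman_measure hX huX
  let i : K → X := inclusion hKX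
  have hi : Measurable i := measurable_inclusion hKX
  have hπK : Measurable fun p : Λ × K => π p.1 (i p.2) :=
    hπ.comp (measurable_fst.prodMk (hi.comp measurable_snd))
  have hEμ := lintegral_edist_rpow_neg_ne_top (NNReal.coe_pos.2 (mul_pos hα hs))
    (by exact_mod_cast hu) hμball
  have hF : Measurable fun q : Λ × (K × K) =>
      edist (π q.1 (i q.2.1)) (π q.1 (i q.2.2)) ^ (-(s : ℝ)) :=
    ((hπK.comp (measurable_fst.prodMk (measurable_fst.comp measurable_snd))).edist
      (hπK.comp (measurable_fst.prodMk (measurable_snd.comp measurable_snd)))).pow_const _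
  set A : ℝ≥0∞ := P univ + 1 + 2 ^ (s : ℝ) * C * (1 - 2 ^ ((s : ℝ) - κ))⁻¹ with hA
  have hAtop : A ≠ ⊤ := lintegral_rpow_neg_bound_ne_top (NNReal.coe_lt_coe.2 hsκ)
    (ENNReal.add_ne_top.2 ⟨measure_ne_top P _, ENNReal.one_ne_top⟩) ENNReal.coe_ne_top
  have hmeasμ : Measurable fun p : K × K => edist p.1 p.2 ^ (-((α * s : ℝ≥0) : ℝ)) :=
    measurable_edist.pow_const _
  have htot : ∫⁻ l, ∫⁻ p, edist (π l (i p.1)) (π l (i p.2)) ^ (-(s : ℝ)) ∂(μ.prod μ) ∂P ≠ ⊤ := by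
    rw [lintegral_lintegral_swap hF.aemeasurable]
    refine ne_top_of_le_ne_top (ENNReal.mul_ne_top hAtop hEμ)
      (le_trans (lintegral_mono fun p => ?_)
      (le_of_eq ((lintegral_const_mul A hmeasμ).trans
        (congrArg (A * ·) (lintegral_prod _ hmeasμ.aemeasurable)))))
    exact (htrans.comp (i := i) fun _ _ => rfl).lintegral_edist_rpow_neg_le
      (fun z => hπK.comp (measurable_id.prodMk measurable_const)) hs hα p.1 p.2
  filter_upwards [ae_lt_top hF.lintegral_prod_right' htot] with l hl
  have hg : Measurable fun z : K => π l (i z) :=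
    hπK.comp (measurable_const.prodMk measurable_id)
  have hFl : Measurable fun p : K × K => edist (π l (i p.1)) (π l (i p.2)) ^ (-(s : ℝ)) :=
    ((hg.comp measurable_fst).edist (hg.comp measurable_snd)).pow_const _
  rw [lintegral_prod _ hFl.aemeasurable] at hl
  exact (le_dimH_range_of_energy_ne_top hμ0 hg hl.ne).trans
    (dimH_mono (range_subset_iff.2 fun z => mem_range_self (i z)))

theorem dimH_univ_subtype {Z : Type*} [MetricSpace Z] (X : Set Z) :
    dimH (univ : Set X) = dimH X := by
  rw [← isometry_subtype_coe.dimH_image, image_univ, Subtype.range_coe]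

theorem theorem1p1 {Z Y Λ : Type*}
    [MetricSpace Z] [CompleteSpace Z] [TopologicalSpace.SeparableSpace Z]
    [MeasurableSpace Z] [BorelSpace Z]
    [MetricSpace Y] [TopologicalSpace.SeparableSpace Y] [MeasurableSpace Y] [BorelSpace Y]
    [MeasurableSpace Λ] (P : Measure Λ) [IsProbabilityMeasure P]
    (X : Set Z) (hX : AnalyticSet X)
    (π : Λ → X → Y) (hπ : Measurable (fun p : Λ × X => π p.1 p.2))
    (α κ C : ℝ≥0) (hα : 0 < α) (hκ : 0 < κ) (hC : 0 < C)
    (htrans : IsTransversal P π α κ C) :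
    (∀ᵐ l ∂P, min (κ : ℝ≥0∞) (dimH X / α) ≤ dimH (range (π l))) ∧
    ((κ : ℝ≥0∞) = dimH (univ : Set Y) →
      (dimH X < (α : ℝ≥0∞) * κ → ∀ l, ∃ K : ℝ≥0, HolderWith K α (π l)) →
      ∀ᵐ l ∂P, dimH (range (π l)) = min (κ : ℝ≥0∞) (dimH X / α)) := by
  have := UniformSpace.secondCountable_of_separable Z
  have := UniformSpace.secondCountable_of_separable Y
  have hα0 : (α : ℝ≥0∞) ≠ 0 := ENNReal.coe_ne_zero.2 hα.ne'
  have hlower : ∀ᵐ l ∂P, min (κ : ℝ≥0∞) (dimH X / α) ≤ dimH (range (π l)) := by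
    -- The null set depends on the exponent, so exponents are restricted to a countable dense set.
    have hq : ∀ q : ℚ, ∀ᵐ l ∂P, ((Real.toNNReal q : ℝ≥0) : ℝ≥0∞) < min (κ : ℝ≥0∞) (dimH X / α) →
        ((Real.toNNReal q : ℝ≥0) : ℝ≥0∞) ≤ dimH (range (π l)) := by
      intro q
      rcases eq_or_lt_of_le (zero_le (a := Real.toNNReal q)) with h0 | h0
      · exact Eventually.of_forall fun l _ => by rw [← h0]; simp
      by_cases hq : ((Real.toNNReal q : ℝ≥0) : ℝ≥0∞) < min (κ : ℝ≥0∞) (dimH X / α)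
      · obtain ⟨h1, h2⟩ := lt_min_iff.1 hq
        rw [ENNReal.lt_div_iff_mul_lt (Or.inl hα0) (Or.inl ENNReal.coe_ne_top), mul_comm] at h2
        filter_upwards [ae_le_dimH_range_of_isTransversal hX hπ hα htrans h0
          (by exact_mod_cast h1) (by exact_mod_cast h2)] with l hl _ using hl
      · exact Eventually.of_forall fun l h => absurd h hq
    filter_upwards [ae_all_iff.2 hq] with l hl
    by_contra! hlt
    obtain ⟨q, _, hq1, hq2⟩ := ENNReal.lt_iff_exists_rat_btwn.1 hlt
    exact absurd (hl q hq2) (not_le.2 hq1)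
  refine ⟨hlower, fun hκY hHolder => ?_⟩
  filter_upwards [hlower] with l hl
  refine le_antisymm (le_min ?_ ?_) hl
  · rw [hκY]
    exact dimH_mono (subset_univ _)
  -- Only for `dimH X < α * κ` is the Hölder bound needed; otherwise `dimH Y = κ ≤ dimH X / α`.
  · rcases lt_or_ge (dimH X) ((α : ℝ≥0∞) * κ) with hlt | hge
    · obtain ⟨K, hK⟩ := hHolder hlt l
      rw [← dimH_univ_subtype X]
      exact hK.dimH_range_le hα
    · rw [ENNReal.le_div_iff_mul_le (Or.inl hα0) (Or.inl ENNReal.coe_ne_top), mul_comm]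
      refine le_trans ?_ hge
      gcongr
      rw [hκY]
      exact dimH_mono (subset_univ _)
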